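/- An input $(G,x)$ is a finite simple graph $G=(V,E)$ with a fractional matching $x=(x_e)_{e\in E}$, that is, $x_e\ge 0$ and $\sum_{e\in\partial(v)}x_e\le 1$ for every $v\in V$. Every edge $e$ is active independently with probability $x_e$. An online contention resolution scheme (OCRS) knows $(G,x)$ in advance. The edges then arrive one by one, in an order that an adversary, who knows the scheme, fixes before the edge states and the scheme's internal randomness are drawn. When an edge arrives, it is revealed whether it is active, and the (randomized) scheme must decide at once whether to select it, on the basis of the input, its internal randomness and the edges and states revealed so far. It may select only active edges, and the selected edges must always form a matching. The scheme is $c$-selectable on $(G,x)$ if, for every arrival order, it selects every edge $e\in E$ with probability at least $c\,x_e$. It is $c$-selectable in the vanishing regime if there is a function $f$ with $\lim_{\varepsilon\to 0^+}f(\varepsilon)=0$ such that it is $(c-f(\max_{e\in E}x_e))$-selectable on every input $(G,x)$. It runs in polynomial time if, on the inputs with rational edge values written in binary, its decisions are computed by a randomized program that uses polynomially many fair random bits and, in the worst case, polynomially many steps per arriving edge, in the length of the binary encoding of the input. **Theorem.** Let $\alpha=\frac{3-\sqrt5}{2}\approx 0.382$, the smaller of the real solutions of $\alpha=(1-\alpha)^2$.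 There is a polynomial-time OCRS that is $\alpha$-selectable in the vanishing regime. -/

import Mathlib

open Filter Topology

namespace Contention

/-! ### Inputs: a finite simple graph together with a fractional matching -/

open scoped Classical in
/-- A finite simple graph `G` on the vertices `0, …, n - 1` with a fractional matching `x`.
Edge values are extended by `0` to pairs that are not edges. -/
structure Input where
  n : ℕ
  G : SimpleGraph (Fin n)
  x : Sym2 (Fin n) → ℝ
  x_nonneg : ∀ e, 0 ≤ x e
  x_off : ∀ e, e ∉ G.edgeSet → x e = 0
  sum_le_one : ∀ v, ∑ e ∈ G.incidenceFinset v, x e ≤ 1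

/-- The largest edge value (`0` if there are no edges). -/
noncomputable def Input.maxValue (I : Input) : ℝ := ⨆ e : I.G.edgeSet, I.x e

/-! ### Online contention resolution schemes -/

/-- What has been revealed up to and including the current arrival: the edges that have arrived,
in order of arrival (the current one is last), each with its state (`true` = active). -/
abbrev History (n : ℕ) := List (Sym2 (Fin n) × Bool)

/-- A deterministic online selection rule: whether to select the edge that has just arrived. -/
abbrev Policy (n : ℕ) := History n → Bool

open scoped Classical in
/-- The history after the edges of `l` have arrived, when `S` is the set of active edges. -/
noncomputable def history {n : ℕ} (S : Finset (Sym2 (Fin n))) (l : List (Sym2 (Fin n))) :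
    History n :=
  l.map fun e => (e, decide (e ∈ S))

/-- The edges that `π` selects if the edges arrive in the order `order` and `S` is the set of
active edges. -/
def selected {n : ℕ} (π : Policy n) (order : List (Sym2 (Fin n))) (S : Finset (Sym2 (Fin n))) :
    Set (Sym2 (Fin n)) :=
  {e | ∃ l, l ++ [e] <+: order ∧ π (history S (l ++ [e])) = true}

/-- `order` lists every edge of the graph exactly once. -/
def IsArrivalOrder (I : Input) (order : List (Sym2 (Fin I.n))) : Prop :=
  order.Nodup ∧ ∀ e, e ∈ order ↔ e ∈ I.G.edgeSet

/-- No two distinct edges of `M` share a vertex. -/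
def IsMatching {n : ℕ} (M : Set (Sym2 (Fin n))) : Prop :=
  ∀ e ∈ M, ∀ f ∈ M, e ≠ f → ∀ v, ¬ (v ∈ e ∧ v ∈ f)

/-- A (randomized) online contention resolution scheme: knowing the input, it draws its internal
randomness, i.e. it draws a deterministic online rule; whatever the arrival order and the edge
states, the rule selects only active edges, and they form a matching. -/
structure OCRS where
  rule : (I : Input) → PMF (Policy I.n)
  valid : ∀ (I : Input), ∀ π ∈ (rule I).support, ∀ order, IsArrivalOrder I order →
    ∀ S : Finset (Sym2 (Fin I.n)), (S : Set (Sym2 (Fin I.n))) ⊆ I.G.edgeSet →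
      selected π order S ⊆ S ∧ IsMatching (selected π order S)

open scoped Classical in
/-- The probability that `S` is the set of active edges, when every edge `e` is active
independently with probability `x e`. -/
noncomputable def Input.stateProb (I : Input) (S : Finset (Sym2 (Fin I.n))) : ℝ :=
  (∏ e ∈ S, I.x e) * ∏ e ∈ I.G.edgeFinset \ S, (1 - I.x e)

open scoped Classical in
/-- The probability, over the edge states and the independent internal randomness of `ψ`, that
`ψ` selects `e` when the edges arrive in the order `order`. -/
noncomputable def OCRS.selectProb (ψ : OCRS) (I : Input) (order : List (Sym2 (Fin I.n)))
    (e : Sym2 (Fin I.n)) : ℝ :=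
  ∑ S ∈ I.G.edgeFinset.powerset,
    I.stateProb S * ((ψ.rule I).toOuterMeasure {π | e ∈ selected π order S}).toReal

/-- `ψ` is `c`-selectable on the input `I`: for every arrival order fixed in advance by the
adversary, every edge `e` is selected with probability at least `c * x e`. -/
def OCRS.SelectableOn (ψ : OCRS) (c : ℝ) (I : Input) : Prop :=
  ∀ order, IsArrivalOrder I order → ∀ e ∈ I.G.edgeSet, c * I.x e ≤ ψ.selectProb I order e

/-- `ψ` is `c`-selectable in the vanishing regime. -/
def OCRS.VanishingSelectable (ψ : OCRS) (c : ℝ) : Prop :=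
  ∃ f : ℝ → ℝ, Tendsto f (𝓝[>] 0) (𝓝 0) ∧ ∀ I : Input, ψ.SelectableOn (c - f I.maxValue) I

/-! ### A random access machine with a step count

Programs use finitely many two-dimensional arrays of natural numbers, addition, truncated
subtraction, assignment, branching and loops. Every evaluated node of an expression, every
assignment and every test is one step. As there is no multiplication, a step can lengthen the
numbers in memory by at most one bit, so that counting steps in this way is polynomially
equivalent to time on a Turing machine. -/

/-- The contents of the cells `(a, i, j)`: entry `(i, j)` of array number `a`. -/
abbrev Memory := ℕ → ℕ → ℕ → ℕ

inductive Expr where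
  | lit (k : ℕ) : Expr
  | get (a : ℕ) (i j : Expr) : Expr
  | add (e₁ e₂ : Expr) : Expr
  | sub (e₁ e₂ : Expr) : Expr

def Expr.eval (σ : Memory) : Expr → ℕ
  | .lit k => k
  | .get a i j => σ a (i.eval σ) (j.eval σ)
  | .add e₁ e₂ => e₁.eval σ + e₂.eval σ
  | .sub e₁ e₂ => e₁.eval σ - e₂.eval σ

/-- The number of steps that the evaluation of an expression takes. -/
def Expr.cost : Expr → ℕ
  | .lit _ => 1
  | .get _ i j => i.cost + j.cost + 1
  | .add e₁ e₂ => e₁.cost + e₂.cost + 1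
  | .sub e₁ e₂ => e₁.cost + e₂.cost + 1

inductive Program where
  | skip : Program
  | set (a : ℕ) (i j e : Expr) : Program
  | seq (p₁ p₂ : Program) : Program
  | ite (b : Expr) (p₁ p₂ : Program) : Program
  | loop (b : Expr) (p : Program) : Program

/-- Write `k` into the cell `(a, i, j)`. -/
def Memory.write (σ : Memory) (a i j k : ℕ) : Memory :=
  fun a' i' j' => if a' = a ∧ i' = i ∧ j' = j then k else σ a' i' j'

/-- `Exec p σ t τ`: started with memory `σ`, the program `p` halts after `t` steps with
memory `τ`. A test succeeds if its value is not `0`; `loop b p` is "while `b` do `p`". -/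
inductive Exec : Program → Memory → ℕ → Memory → Prop where
  | skip (σ : Memory) : Exec .skip σ 1 σ
  | set (a : ℕ) (i j e : Expr) (σ : Memory) :
      Exec (.set a i j e) σ (i.cost + j.cost + e.cost + 1)
        (σ.write a (i.eval σ) (j.eval σ) (e.eval σ))
  | seq {p₁ p₂ : Program} {σ τ ρ : Memory} {t₁ t₂ : ℕ} :
      Exec p₁ σ t₁ τ → Exec p₂ τ t₂ ρ → Exec (.seq p₁ p₂) σ (t₁ + t₂) ρ
  | ite_true {b : Expr} {p₁ p₂ : Program} {σ τ : Memory} {t : ℕ} :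
      b.eval σ ≠ 0 → Exec p₁ σ t τ → Exec (.ite b p₁ p₂) σ (b.cost + 1 + t) τ
  | ite_false {b : Expr} {p₁ p₂ : Program} {σ τ : Memory} {t : ℕ} :
      b.eval σ = 0 → Exec p₂ σ t τ → Exec (.ite b p₁ p₂) σ (b.cost + 1 + t) τ
  | loop_done {b : Expr} {p : Program} {σ : Memory} :
      b.eval σ = 0 → Exec (.loop b p) σ (b.cost + 1) σ
  | loop_step {b : Expr} {p : Program} {σ τ ρ : Memory} {t₁ t₂ : ℕ} :
      b.eval σ ≠ 0 → Exec p σ t₁ τ → Exec (.loop b p) τ t₂ ρ →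
        Exec (.loop b p) σ (b.cost + 1 + t₁ + t₂) ρ

/-! ### Polynomial-time schemes -/

/-- The length of the binary encoding of a graph (adjacency matrix) with rational edge values
`q` (numerators and denominators). -/
noncomputable def Input.bitLength (I : Input) (q : Sym2 (Fin I.n) → ℚ) : ℕ :=
  ∑ u, ∑ v, (1 + (q s(u, v)).num.toNat.size + (q s(u, v)).den.size)

open scoped Classical in
/-- The initial memory: array 0 holds the number of vertices, array 1 the number of edges that
have arrived, array 2 the adjacency matrix, arrays 3 and 4 the numerators and denominators of the
edge values, array 5 the random bits, and row `i` of array 6 the endpoints of the `i`-th arrived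
edge and its state. All other cells are `0`. -/
noncomputable def initialMemory (I : Input) (q : Sym2 (Fin I.n) → ℚ) {N : ℕ} (R : Fin N → Bool)
    (h : History I.n) : Memory := fun a i j =>
  match a with
  | 0 => if i = 0 ∧ j = 0 then I.n else 0
  | 1 => if i = 0 ∧ j = 0 then h.length else 0
  | 2 => if hij : i < I.n ∧ j < I.n then
      (if I.G.Adj ⟨i, hij.1⟩ ⟨j, hij.2⟩ then 1 else 0) else 0
  | 3 => if hij : i < I.n ∧ j < I.n then (q s(⟨i, hij.1⟩, ⟨j, hij.2⟩)).num.toNat else 0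
  | 4 => if hij : i < I.n ∧ j < I.n then (q s(⟨i, hij.1⟩, ⟨j, hij.2⟩)).den else 0
  | 5 => if hi : i < N ∧ j = 0 then (R ⟨i, hi.1⟩).toNat else 0
  | 6 => match h[i]?, j with
    | some (e, _), 0 => (e.inf : Fin I.n)
    | some (e, _), 1 => (e.sup : Fin I.n)
    | some (_, b), 2 => b.toNat
    | _, _ => 0
  | _ => 0

open scoped Classical in
/-- The online rule computed by a program with the random bits `R`: the arrived edge is selected
if the program halts with a nonzero number in the cell `(7, 0, 0)`. -/
noncomputable def Program.policy (p : Program) (I : Input) (q : Sym2 (Fin I.n) → ℚ) {N : ℕ}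
    (R : Fin N → Bool) : Policy I.n :=
  fun h => decide (∃ t τ, Exec p (initialMemory I q R h) t τ ∧ τ 7 0 0 ≠ 0)

/-- `ψ` runs in polynomial time: on inputs with rational edge values, its decisions are computed
by one program, which uses polynomially many independent fair random bits, drawn once and for
all, and takes polynomially many steps per arriving edge, in the worst case. -/
def OCRS.PolyTime (ψ : OCRS) : Prop :=
  ∃ (p : Program) (time bits : Polynomial ℕ),
    ∀ (I : Input) (q : Sym2 (Fin I.n) → ℚ), (∀ e, I.x e = q e) →
      ψ.rule I = (PMF.uniformOfFintype (Fin (bits.eval (I.bitLength q)) → Bool)).map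
        (fun R => p.policy I q R) ∧
      ∀ (R : Fin (bits.eval (I.bitLength q)) → Bool) (h : History I.n),
        (h.map Prod.fst).Nodup → (∀ a ∈ h, a.1 ∈ I.G.edgeSet) →
          ∃ t τ, Exec p (initialMemory I q R h) t τ ∧ t ≤ time.eval (I.bitLength q)

end Contention

/-!
Put `β = 1 - α`, so that `β ^ 2 = α`. When an edge `e` with endpoints `u`, `w` arrives after edges
of total value `s` at `u` and `t` at `w`, the scheme lets it pass with probability about `a s * a
t`, where `a s = β / (1 - α * s)` (`accept`), by coins that are independent of everything else; it
selects `e` if `e` is active, passes, and has two unmatched endpoints. Ideally a vertex that has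
seen edges of total value `s` is unmatched with probability `1 - α * s`, and the two endpoints of
an edge are unmatched almost independently. Then `e` is selected with probability `x e * a s * a t
* (1 - α * s) * (1 - α * t) = x e * β ^ 2 = α * x e`, which in turn reproduces the ideal
probabilities at `u` and `w`.

*Decorrelation.* The set of matched vertices is a Markov chain with independent updates
(`chainE`). The covariance of observables of disjoint vertex sets is bounded by a sum over pairs
of vertices (`CovBound`). An arriving edge with exactly one endpoint in one of the sets and none
in the other passes on the bound of its other endpoint, weighted by its rate; an edge that joins
the sets adds a multiple of its rate, which is at most `ε = maxValue`, and does so only once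
(`CovBound.step`). Because `a` is convex, `a s ≤ β + α * s`, and the total influence on a vertex
stays below the quadratic `potential`, whose value at `1` is `2 / α`: a bounded constant, whatever
the size and the shape of the graph. Hence two vertices are unmatched independently up to `O(ε)`
(`abs_cov_free_le`). The error in the probability that a single vertex is unmatched is also `O(ε)`
(`abs_chainE_free_sub_le`), because the new error at `u` is the old one, damped, plus at most `x e
* β` times the error at `w`, with `β < 1`. The result is `rate_mul_chainE_free_ge`, which also
allows for coins that are slightly too small (`NearIdeal`).

*Coins.* Fair bits yield a coin of irrational probability `β` through a walk: from position `1`,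
going up by `2` or down by `1`, it reaches `0` with probability exactly `β`, since `β ^ 3 - 2 * β
+ 1 = 0` (`one_sub_goldenAlpha_harmonic`); truncating it after `K` steps costs an exponentially
small error (`le_walkProb`). The equation `a s = β + α * s * a s` turns walks and uniform `K`-bit
numbers into coins of probability about `a s` (`coin`, `accept_sub_coinProb_le`). Here `K` is the
total length of the denominators (`Input.precision`), so `2 ^ K` is at least `n` divided by any
positive edge value, and all errors together are at most `1200 * ε ^ (1 / 20)`
(`Input.le_sum_activeProb_chooses`).

*Running time.* Memory states of the machine are described by a record `Regs` of variables. The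
program replays all arrivals so far, each with its own block of `4 * K ^ 2` random bits, and
computes the binary digits of the edge values by long division (`runs_schemeProgram`). On inputs
with irrational values the same scheme is used with digits that are not computed by a program.
-/

namespace Contention

/-! ### Covariance bounds for random matchings -/

section Chain

variable {V : Type*} [DecidableEq V]

open scoped Classical in
/-- The effect on the set of matched vertices (indicator `s`) of trying to select `e`: if no
endpoint of `e` is matched, its endpoints become matched; otherwise nothing happens. -/
noncomputable def matchUp (e : Sym2 V) (s : V → Bool) : V → Bool :=
  fun v => s v || (decide (v ∈ e) && decide (∀ w ∈ e, s w = false))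

lemma matchUp_apply_mk (u w : V) (s : V → Bool) (v : V) :
    matchUp s(u, w) s v = (s v || (decide (v = u ∨ v = w) && (!s u && !s w))) := by
  simp [matchUp, Bool.decide_and]

/-- The expectation operator of the Markov chain on sets of matched vertices in which, when `e`
arrives after the edges of `l` (most recent first), it is tried with probability `rate l e`,
independently of the past. -/
noncomputable def chainE (rate : List (Sym2 V) → Sym2 V → ℝ) :
    List (Sym2 V) → ((V → Bool) → ℝ) → ℝ
  | [], φ => φ fun _ => false
  | e :: l, φ => (1 - rate l e) * chainE rate l φ +
      rate l e * chainE rate l fun s => φ (matchUp e s)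

variable {rate : List (Sym2 V) → Sym2 V → ℝ}

lemma chainE_add (l : List (Sym2 V)) (φ ψ : (V → Bool) → ℝ) :
    chainE rate l (fun s => φ s + ψ s) = chainE rate l φ + chainE rate l ψ := by
  induction l generalizing φ ψ with
  | nil => rfl
  | cons e l ih =>
    simp only [chainE]
    rw [ih, ih (fun s => φ (matchUp e s)) (fun s => ψ (matchUp e s))]
    ring

lemma chainE_const_mul (l : List (Sym2 V)) (c : ℝ) (φ : (V → Bool) → ℝ) :
    chainE rate l (fun s => c * φ s) = c * chainE rate l φ := by
  induction l generalizing φ with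
  | nil => rfl
  | cons e l ih =>
    simp only [chainE]
    rw [ih, ih (fun s => φ (matchUp e s))]
    ring

lemma chainE_const (l : List (Sym2 V)) (c : ℝ) : chainE rate l (fun _ => c) = c := by
  induction l with
  | nil => rfl
  | cons e l ih => simp only [chainE]; rw [ih]; ring

lemma chainE_sub (l : List (Sym2 V)) (φ ψ : (V → Bool) → ℝ) :
    chainE rate l (fun s => φ s - ψ s) = chainE rate l φ - chainE rate l ψ := by
  have h := chainE_add (rate := rate) l φ (fun s => (-1) * ψ s)
  rw [chainE_const_mul] at h
  rw [sub_eq_add_neg, ← neg_one_mul, ← h]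
  congr 1; ext s; ring

lemma chainE_mono (h0 : ∀ l e, 0 ≤ rate l e) (h1 : ∀ l e, rate l e ≤ 1) (l : List (Sym2 V))
    {φ ψ : (V → Bool) → ℝ} (h : ∀ s, φ s ≤ ψ s) : chainE rate l φ ≤ chainE rate l ψ := by
  induction l generalizing φ ψ with
  | nil => exact h _
  | cons e l ih =>
    simp only [chainE]
    have := ih h
    have := ih fun s => h (matchUp e s)
    have := h0 l e
    have := sub_nonneg.2 (h1 l e)
    gcongr

lemma abs_chainE_le (h0 : ∀ l e, 0 ≤ rate l e) (h1 : ∀ l e, rate l e ≤ 1) (l : List (Sym2 V))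
    {φ : (V → Bool) → ℝ} {c : ℝ} (h : ∀ s, |φ s| ≤ c) : |chainE rate l φ| ≤ c := by
  rw [abs_le]
  constructor
  · rw [← chainE_const (rate := rate) l (-c)]
    exact chainE_mono h0 h1 l fun s => (abs_le.1 (h s)).1
  · rw [← chainE_const (rate := rate) l c]
    exact chainE_mono h0 h1 l fun s => (abs_le.1 (h s)).2

/-- `κ` bounds the covariance, under the expectation `E`, of observables of disjoint vertex sets:
every pair of a vertex of one set and a vertex of the other contributes its value of `κ`. -/
def CovBound (E : ((V → Bool) → ℝ) → ℝ) (κ : V → V → ℝ) : Prop :=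
  ∀ (A B : Finset V) (φ ψ : (V → Bool) → ℝ), Disjoint A B → DependsOn φ A → DependsOn ψ B →
    (∀ s, |φ s| ≤ 1) → (∀ s, |ψ s| ≤ 1) →
    |E (fun s => φ s * ψ s) - E φ * E ψ| ≤ ∑ a ∈ A, ∑ b ∈ B, κ a b

lemma dependsOn_comp_matchUp {φ : (V → Bool) → ℝ} {A : Finset V} (h : DependsOn φ A) (u w : V) :
    DependsOn (fun s => φ (matchUp s(u, w) s)) (insert u (insert w A) : Finset V) := by
  intro s t hst
  apply h
  intro a ha
  have hu := hst u (by simp)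
  have hw := hst w (by simp)
  have ha' := hst a (by simp at ha; simp [ha])
  rw [matchUp_apply_mk, matchUp_apply_mk, hu, hw, ha']

lemma comp_matchUp_of_dependsOn {φ : (V → Bool) → ℝ} {A : Finset V} (h : DependsOn φ A) {u w : V}
    (hu : u ∉ A) (hw : w ∉ A) (s : V → Bool) : φ (matchUp s(u, w) s) = φ s := by
  apply h
  intro a ha
  have h1 : a ≠ u := fun h => hu (h ▸ ha)
  have h2 : a ≠ w := fun h => hw (h ▸ ha)
  rw [matchUp_apply_mk]; simp [h1, h2]

/-- If the arriving edge misses `B`, it can only spread the dependence of `φ` from one endpoint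
to the other, and it does so with probability `rate l s(u, w)`. -/
lemma cov_step_of_not_mem (h0 : ∀ l e, 0 ≤ rate l e) (h1 : ∀ l e, rate l e ≤ 1)
    {l : List (Sym2 V)} {u w : V} {κ κ' : V → V → ℝ} (hE : CovBound (chainE rate l) κ)
    (hκ : ∀ a b, κ a b ≤ κ' a b)
    (hu : ∀ b, b ≠ u → b ≠ w → κ u b + rate l s(u, w) * κ w b ≤ κ' u b)
    (hw : ∀ b, b ≠ u → b ≠ w → κ w b + rate l s(u, w) * κ u b ≤ κ' w b)
    {A B : Finset V} {φ ψ : (V → Bool) → ℝ} (hAB : Disjoint A B) (hφ : DependsOn φ A)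
    (hψ : DependsOn ψ B) (hφ1 : ∀ s, |φ s| ≤ 1) (hψ1 : ∀ s, |ψ s| ≤ 1) (huB : u ∉ B)
    (hwB : w ∉ B) :
    |chainE rate (s(u, w) :: l) (fun s => φ s * ψ s) -
      chainE rate (s(u, w) :: l) φ * chainE rate (s(u, w) :: l) ψ| ≤
        ∑ a ∈ A, ∑ b ∈ B, κ' a b := by
  have hy0 := h0 l s(u, w)
  have hy1 := h1 l s(u, w)
  simp only [chainE, comp_matchUp_of_dependsOn hψ huB hwB]
  set y := rate l s(u, w)
  have hrow : ∀ a, ∑ b ∈ B, κ a b ≤ ∑ b ∈ B, κ' a b := fun a => Finset.sum_le_sum fun b _ => hκ a b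
  have hne : ∀ b ∈ B, b ≠ u ∧ b ≠ w := fun b hb =>
    ⟨fun h => huB (h ▸ hb), fun h => hwB (h ▸ hb)⟩
  have hrow_u : ∑ b ∈ B, κ u b + y * ∑ b ∈ B, κ w b ≤ ∑ b ∈ B, κ' u b := by
    rw [Finset.mul_sum, ← Finset.sum_add_distrib]
    exact Finset.sum_le_sum fun b hb => hu b (hne b hb).1 (hne b hb).2
  have hrow_w : ∑ b ∈ B, κ w b + y * ∑ b ∈ B, κ u b ≤ ∑ b ∈ B, κ' w b := by
    rw [Finset.mul_sum, ← Finset.sum_add_distrib]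
    exact Finset.sum_le_sum fun b hb => hw b (hne b hb).1 (hne b hb).2
  have hsum := Finset.sum_le_sum fun a (_ : a ∈ A) => hrow a
  have hc0 := hE A B φ ψ hAB hφ hψ hφ1 hψ1
  have hφ1' : ∀ s, |φ (matchUp s(u, w) s)| ≤ 1 := fun s => hφ1 _
  -- it suffices to bound the covariance of `φ ∘ matchUp` and `ψ` before the arrival
  have key : ∀ d, |chainE rate l (fun s => φ (matchUp s(u, w) s) * ψ s) -
      chainE rate l (fun s => φ (matchUp s(u, w) s)) * chainE rate l ψ| ≤
        ∑ a ∈ A, ∑ b ∈ B, κ a b + d →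
      ∑ a ∈ A, ∑ b ∈ B, κ a b + y * d ≤ ∑ a ∈ A, ∑ b ∈ B, κ' a b →
      |(1 - y) * chainE rate l (fun s => φ s * ψ s) +
          y * chainE rate l (fun s => φ (matchUp s(u, w) s) * ψ s) -
        ((1 - y) * chainE rate l φ + y * chainE rate l (fun s => φ (matchUp s(u, w) s))) *
          ((1 - y) * chainE rate l (fun s => ψ s) + y * chainE rate l fun s => ψ s)| ≤
        ∑ a ∈ A, ∑ b ∈ B, κ' a b := by
    intro d hd hle
    set p := chainE rate l (fun s => φ s * ψ s)
    set p' := chainE rate l (fun s => φ (matchUp s(u, w) s) * ψ s)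
    set f := chainE rate l φ
    set f' := chainE rate l (fun s => φ (matchUp s(u, w) s))
    set g := chainE rate l (fun s => ψ s)
    have e1 : (1 - y) * p + y * p' - ((1 - y) * f + y * f') * ((1 - y) * g + y * g) =
        (1 - y) * (p - f * g) + y * (p' - f' * g) := by ring
    rw [e1]
    calc _ ≤ |(1 - y) * (p - f * g)| + |y * (p' - f' * g)| := abs_add_le _ _
      _ = (1 - y) * |p - f * g| + y * |p' - f' * g| := by
          rw [abs_mul, abs_mul, abs_of_nonneg hy0, abs_of_nonneg (sub_nonneg.2 hy1)]
      _ ≤ (1 - y) * (∑ a ∈ A, ∑ b ∈ B, κ a b) + y * (∑ a ∈ A, ∑ b ∈ B, κ a b + d) := by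
          have := sub_nonneg.2 hy1
          gcongr
      _ = ∑ a ∈ A, ∑ b ∈ B, κ a b + y * d := by ring
      _ ≤ _ := hle
  have hins : ∀ v ∈ A, ∀ r, ∑ b ∈ B, κ v b + r ≤ ∑ b ∈ B, κ' v b →
      ∑ a ∈ A, ∑ b ∈ B, κ a b + r ≤ ∑ a ∈ A, ∑ b ∈ B, κ' a b := by
    intro v hv r hr
    rw [← Finset.add_sum_erase A _ hv, ← Finset.add_sum_erase A _ hv]
    have := Finset.sum_le_sum fun a (_ : a ∈ A.erase v) => hrow a
    linarith
  by_cases hA : u ∈ A ∨ w ∈ A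
  · have hd : Disjoint (insert u (insert w A)) B := by
      simp [Finset.disjoint_insert_left, huB, hwB, hAB]
    have hc1 := hE _ B _ ψ hd (dependsOn_comp_matchUp hφ u w) hψ hφ1' hψ1
    by_cases huA : u ∈ A
    · rw [Finset.insert_eq_of_mem (Finset.mem_insert_of_mem huA)] at hc1
      by_cases hwA : w ∈ A
      · rw [Finset.insert_eq_of_mem hwA] at hc1
        exact key 0 (by simpa using hc1) (by simpa using hsum)
      · rw [Finset.sum_insert hwA, add_comm] at hc1
        exact key _ hc1 (hins u huA _ hrow_u)
    · have hwA : w ∈ A := hA.resolve_left huA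
      rw [Finset.insert_eq_of_mem hwA, Finset.sum_insert huA, add_comm] at hc1
      exact key _ hc1 (hins w hwA _ hrow_w)
  · push Not at hA
    refine key 0 ?_ (by simpa using hsum)
    simpa only [comp_matchUp_of_dependsOn hφ hA.1 hA.2, add_zero] using hc0

/-- An edge joining `A` and `B` changes each of `E (φ ψ)`, `E φ` and `E ψ` by at most twice its
rate. -/
lemma cov_step_of_joins (h0 : ∀ l e, 0 ≤ rate l e) (h1 : ∀ l e, rate l e ≤ 1)
    {l : List (Sym2 V)} {u w : V} {κ κ' : V → V → ℝ} (hE : CovBound (chainE rate l) κ)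
    (hκ : ∀ a b, κ a b ≤ κ' a b) (huw : κ u w + 6 * rate l s(u, w) ≤ κ' u w)
    {A B : Finset V} {φ ψ : (V → Bool) → ℝ} (hAB : Disjoint A B) (hφ : DependsOn φ A)
    (hψ : DependsOn ψ B) (hφ1 : ∀ s, |φ s| ≤ 1) (hψ1 : ∀ s, |ψ s| ≤ 1) (huA : u ∈ A)
    (hwB : w ∈ B) :
    |chainE rate (s(u, w) :: l) (fun s => φ s * ψ s) -
      chainE rate (s(u, w) :: l) φ * chainE rate (s(u, w) :: l) ψ| ≤
        ∑ a ∈ A, ∑ b ∈ B, κ' a b := by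
  have hy0 := h0 l s(u, w)
  have hc0 := hE A B φ ψ hAB hφ hψ hφ1 hψ1
  have hsum : ∑ a ∈ A, ∑ b ∈ B, κ a b + 6 * rate l s(u, w) ≤ ∑ a ∈ A, ∑ b ∈ B, κ' a b := by
    have hr : ∑ b ∈ B, κ u b + 6 * rate l s(u, w) ≤ ∑ b ∈ B, κ' u b := by
      rw [← Finset.add_sum_erase B _ hwB, ← Finset.add_sum_erase B _ hwB]
      have := Finset.sum_le_sum fun b (_ : b ∈ B.erase w) => hκ u b
      linarith
    rw [← Finset.add_sum_erase A _ huA, ← Finset.add_sum_erase A _ huA]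
    have := Finset.sum_le_sum fun a (_ : a ∈ A.erase u) =>
      Finset.sum_le_sum fun b (_ : b ∈ B) => hκ a b
    linarith
  have hφψ1 : ∀ s, |φ s * ψ s| ≤ 1 := fun s => by
    rw [abs_mul]; exact mul_le_one₀ (hφ1 s) (abs_nonneg _) (hψ1 s)
  have change : ∀ θ : (V → Bool) → ℝ, (∀ s, |θ s| ≤ 1) →
      |chainE rate (s(u, w) :: l) θ - chainE rate l θ| ≤ 2 * rate l s(u, w) := by
    intro θ hθ
    have e1 : chainE rate (s(u, w) :: l) θ - chainE rate l θ = rate l s(u, w) *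
        (chainE rate l (fun s => θ (matchUp s(u, w) s)) - chainE rate l θ) := by
      simp only [chainE]; ring
    rw [e1, abs_mul, abs_of_nonneg hy0, mul_comm]
    have i1 := abs_chainE_le h0 h1 l hθ
    have i2 := abs_chainE_le h0 h1 l (φ := fun s => θ (matchUp s(u, w) s)) fun s => hθ _
    have := abs_sub (chainE rate l fun s => θ (matchUp s(u, w) s)) (chainE rate l θ)
    gcongr
    linarith
  have c1 := change _ hφψ1
  have c2 := change _ hφ1
  have c3 := change _ hψ1
  have b1 := abs_chainE_le h0 h1 (s(u, w) :: l) hφ1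
  have b2 := abs_chainE_le h0 h1 l hψ1
  set P := chainE rate (s(u, w) :: l) (fun s => φ s * ψ s)
  set p := chainE rate l (fun s => φ s * ψ s)
  set F := chainE rate (s(u, w) :: l) φ
  set f := chainE rate l φ
  set G := chainE rate (s(u, w) :: l) ψ
  set g := chainE rate l ψ
  have e1 : P - F * G = (p - f * g) + ((P - p) - (F * (G - g) + (F - f) * g)) := by ring
  have m1 : |F * (G - g)| ≤ 2 * rate l s(u, w) := by
    rw [abs_mul]; exact (mul_le_of_le_one_left (abs_nonneg _) b1).trans c3
  have m2 : |(F - f) * g| ≤ 2 * rate l s(u, w) := by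
    rw [abs_mul]; exact (mul_le_of_le_one_right (abs_nonneg _) b2).trans c2
  rw [e1]
  rw [abs_le] at *
  constructor <;> linarith

lemma CovBound.step (h0 : ∀ l e, 0 ≤ rate l e) (h1 : ∀ l e, rate l e ≤ 1)
    {l : List (Sym2 V)} {u w : V} {κ κ' : V → V → ℝ} (hE : CovBound (chainE rate l) κ)
    (hκ : ∀ a b, κ a b ≤ κ' a b)
    (hu : ∀ b, b ≠ u → b ≠ w → κ u b + rate l s(u, w) * κ w b ≤ κ' u b)
    (hw : ∀ b, b ≠ u → b ≠ w → κ w b + rate l s(u, w) * κ u b ≤ κ' w b)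
    (huw : κ u w + 6 * rate l s(u, w) ≤ κ' u w)
    (hsymm : ∀ a b, κ a b = κ b a) (hsymm' : ∀ a b, κ' a b = κ' b a) :
    CovBound (chainE rate (s(u, w) :: l)) κ' := by
  intro A B φ ψ hAB hφ hψ hφ1 hψ1
  by_cases hB : u ∉ B ∧ w ∉ B
  · exact cov_step_of_not_mem h0 h1 hE hκ hu hw hAB hφ hψ hφ1 hψ1 hB.1 hB.2
  by_cases hA : u ∉ A ∧ w ∉ A
  · have := cov_step_of_not_mem h0 h1 hE hκ hu hw hAB.symm hψ hφ hψ1 hφ1 hA.1 hA.2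
    rw [Finset.sum_comm] at this
    simpa only [mul_comm, hsymm'] using this
  by_cases huA : u ∈ A
  · have huB : u ∉ B := Finset.disjoint_left.1 hAB huA
    have hwB : w ∈ B := by tauto
    exact cov_step_of_joins h0 h1 hE hκ huw hAB hφ hψ hφ1 hψ1 huA hwB
  · have hwA : w ∈ A := by tauto
    have hwB : w ∉ B := Finset.disjoint_left.1 hAB hwA
    have huB : u ∈ B := by tauto
    rw [Sym2.eq_swap] at huw ⊢
    refine cov_step_of_joins h0 h1 hE hκ ?_ hAB hφ hψ hφ1 hψ1 hwA huB
    rw [hsymm w u, hsymm' w u]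
    exact huw

end Chain

/-! ### The ideal acceptance probabilities -/

section Potential

/-- The smaller solution of `α = (1 - α) ^ 2`. -/
noncomputable def goldenAlpha : ℝ := (3 - √5) / 2

local notation "α" => goldenAlpha

lemma goldenAlpha_eq : α = (1 - α) ^ 2 := by
  have h : √5 ^ 2 = 5 := Real.sq_sqrt (by norm_num)
  unfold goldenAlpha
  linear_combination (-1 / 4) * h

lemma goldenAlpha_gt : 0.38 < α := by
  have h : √5 < 2.24 := by rw [Real.sqrt_lt' (by norm_num)]; norm_num
  unfold goldenAlpha; linarith

lemma goldenAlpha_lt : α < 0.39 := by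
  have h : 2.22 < √5 := by rw [Real.lt_sqrt (by norm_num)]; norm_num
  unfold goldenAlpha; linarith

/-- The ideal acceptance probability contributed by an endpoint that has seen edges of total value
`s`; it is the reciprocal, up to the factor `1 - α`, of the probability that the endpoint is
free. -/
noncomputable def accept (s : ℝ) : ℝ := (1 - α) / (1 - α * s)

lemma one_sub_le_one_sub_mul {s : ℝ} (h1 : s ≤ 1) : 1 - α ≤ 1 - α * s := by
  have := goldenAlpha_gt
  nlinarith

lemma accept_nonneg {s : ℝ} (h1 : s ≤ 1) : 0 ≤ accept s := by
  have := one_sub_le_one_sub_mul h1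
  have := goldenAlpha_lt
  exact div_nonneg (by linarith) (by linarith)

lemma accept_le_one {s : ℝ} (h1 : s ≤ 1) : accept s ≤ 1 := by
  have := one_sub_le_one_sub_mul h1
  have := goldenAlpha_lt
  exact (div_le_one (by linarith)).2 (by linarith)

/-- `accept` is convex, so it lies below its chord on `[0, 1]`. -/
lemma accept_le_chord {s : ℝ} (h0 : 0 ≤ s) (h1 : s ≤ 1) : accept s ≤ 1 - α + α * s := by
  have := one_sub_le_one_sub_mul h1
  have := goldenAlpha_lt
  unfold accept
  rw [div_le_iff₀ (by linarith)]
  have : 0 ≤ α ^ 2 * (s * (1 - s)) := by have := sub_nonneg.2 h1; positivity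
  nlinarith

lemma accept_mul {s : ℝ} (h1 : s ≤ 1) : accept s * (1 - α * s) = 1 - α := by
  have := one_sub_le_one_sub_mul h1
  have := goldenAlpha_lt
  exact div_mul_cancel₀ _ (by linarith)

/-- A bound for the expected number of vertices whose state influences a vertex that has seen
edges of total value `s`. The quadratic is chosen so that its slope is `2 / α` times the chord of
`accept`, and so that its value at `1` is again `2 / α`. -/
noncomputable def potential (s : ℝ) : ℝ := 1 + 2 / α * ((1 - α) * s + α * s ^ 2 / 2)

lemma potential_zero : potential 0 = 1 := by simp [potential]

lemma potential_one : potential 1 = 2 / α := by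
  have := goldenAlpha_gt
  have : α ≠ 0 := by linarith
  unfold potential; field_simp; ring

lemma potential_mono {s t : ℝ} (h0 : 0 ≤ s) (h : s ≤ t) : potential s ≤ potential t := by
  have := goldenAlpha_gt
  have := goldenAlpha_lt
  have : (0 : ℝ) ≤ 1 - α := by linarith
  have : (0 : ℝ) ≤ α := by linarith
  unfold potential
  gcongr

lemma one_le_potential {s : ℝ} (h0 : 0 ≤ s) : 1 ≤ potential s :=
  potential_zero ▸ potential_mono le_rfl h0

lemma potential_le {s : ℝ} (h0 : 0 ≤ s) (h1 : s ≤ 1) : potential s ≤ 2 / α :=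
  potential_one ▸ potential_mono h0 h1

/-- The quadratic grows fast enough to absorb what a vertex inherits from the other endpoint of an
arriving edge. -/
lemma potential_add {s t x y : ℝ} (hs : 0 ≤ s) (ht : 0 ≤ t) (hx : 0 ≤ x) (hy0 : 0 ≤ y)
    (hy : y ≤ x * (accept s * accept t)) (hs1 : s ≤ 1) (ht1 : t ≤ 1) :
    potential s + y * potential t ≤ potential (s + x) := by
  have h1 := goldenAlpha_gt
  have h2 := goldenAlpha_lt
  have hα : (0 : ℝ) < α := by linarith
  have hy' : y ≤ x * (1 - α + α * s) := hy.trans <| by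
    gcongr
    exact (mul_le_of_le_one_right (accept_nonneg hs1) (accept_le_one ht1)).trans
      (accept_le_chord hs hs1)
  calc potential s + y * potential t ≤ potential s + x * (1 - α + α * s) * (2 / α) := by
        have := potential_le ht ht1
        have := one_le_potential ht
        have : 0 ≤ x * (1 - α + α * s) := hy0.trans hy'
        gcongr
    _ ≤ potential (s + x) := by
        unfold potential
        have : 0 ≤ 2 / α * (α * x ^ 2 / 2) := by positivity
        linarith

end Potential

/-! ### The error in the probability that a vertex is free -/

section Free

variable {V : Type*}

/-- The indicator that `v` is not matched. -/
def free (v : V) (s : V → Bool) : ℝ := if s v then 0 else 1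

lemma free_nonneg (v : V) (s : V → Bool) : 0 ≤ free v s := by unfold free; split_ifs <;> simp

lemma free_le_one (v : V) (s : V → Bool) : free v s ≤ 1 := by unfold free; split_ifs <;> simp

lemma abs_free_le (v : V) (s : V → Bool) : |free v s| ≤ 1 := by
  rw [abs_of_nonneg (free_nonneg v s)]; exact free_le_one v s

lemma dependsOn_free (v : V) : DependsOn (free v) ({v} : Finset V) := by
  intro s t h
  simp [free, h v (by simp)]

end Free

section Analysis

local notation "α" => goldenAlpha

variable {V : Type*} [DecidableEq V]

open scoped Classical in
/-- The total value of the edges of `l` at each vertex. -/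
noncomputable def load {M : Type*} [AddMonoid M] (z : Sym2 V → M) : List (Sym2 V) → V → M
  | [], _ => 0
  | e :: l, v => load z l v + if v ∈ e then z e else 0

lemma load_nonneg {x : Sym2 V → ℝ} (hx : ∀ e, 0 ≤ x e) (l : List (Sym2 V)) (v : V) :
    0 ≤ load x l v := by
  induction l with
  | nil => exact le_rfl
  | cons e l ih => simp only [load]; split_ifs <;> simp [ih, hx, add_nonneg]

/-- The edges of `l` are distinct, none is a loop, and their values form a fractional matching. -/
def Admissible (x : Sym2 V → ℝ) (l : List (Sym2 V)) : Prop :=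
  l.Nodup ∧ (∀ e ∈ l, ¬ e.IsDiag) ∧ ∀ v, load x l v ≤ 1

lemma load_le_load_cons {x : Sym2 V → ℝ} (hx : ∀ e, 0 ≤ x e) (e : Sym2 V) (l : List (Sym2 V))
    (v : V) : load x l v ≤ load x (e :: l) v := by
  simp only [load]; split_ifs <;> simp [hx]

lemma Admissible.of_cons {x : Sym2 V → ℝ} (hx : ∀ e, 0 ≤ x e) {e : Sym2 V} {l : List (Sym2 V)}
    (h : Admissible x (e :: l)) : Admissible x l :=
  ⟨h.1.of_cons, fun f hf => h.2.1 f (List.mem_cons_of_mem _ hf),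
    fun v => (load_le_load_cons hx e l v).trans (h.2.2 v)⟩

/-- The rates `rate l e` are the ideal rates `x e * accept * accept` up to a relative error `δ`
from below. -/
def NearIdeal (x : Sym2 V → ℝ) (δ : ℝ) (rate : List (Sym2 V) → Sym2 V → ℝ) : Prop :=
  ∀ l u w, Admissible x (s(u, w) :: l) →
    rate l s(u, w) ≤ x s(u, w) * (accept (load x l u) * accept (load x l w)) ∧
    x s(u, w) * (accept (load x l u) * accept (load x l w) - δ) ≤ rate l s(u, w)

/-- The covariance bound contributed by a pair of vertices: it grows with the two potentials, and
leaves room for the jump at the arrival of the edge joining them, which occurs only once. -/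
noncomputable def pairBound (ε : ℝ) (x : Sym2 V → ℝ) (l : List (Sym2 V)) (a b : V) : ℝ :=
  6 * ε * (potential (load x l a) * potential (load x l b) - if s(a, b) ∈ l then 0 else 1)

variable {rate : List (Sym2 V) → Sym2 V → ℝ} {x : Sym2 V → ℝ} {ε δ : ℝ}

lemma covBound_pairBound (h0 : ∀ l e, 0 ≤ rate l e) (h1 : ∀ l e, rate l e ≤ 1)
    (hx : ∀ e, 0 ≤ x e) (hε : ∀ e, x e ≤ ε) (hε0 : 0 ≤ ε) (hr : NearIdeal x δ rate)
    {l : List (Sym2 V)} (hl : Admissible x l) :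
    CovBound (chainE rate l) (pairBound ε x l) := by
  induction l with
  | nil =>
    intro A B φ ψ _ _ _ _ _
    simp [chainE, pairBound, load, potential_zero]
  | cons e l ih =>
    induction e with | _ u w =>
    have hl' := hl.of_cons hx
    have hne : u ≠ w := fun h => hl.2.1 s(u, w) (by simp) (by simp [h])
    have hnot : s(u, w) ∉ l := (List.nodup_cons.1 hl.1).1
    have hm0 := load_nonneg hx l
    have hm1 := hl'.2.2
    have hP1 : ∀ v, 1 ≤ potential (load x l v) := fun v => one_le_potential (hm0 v)
    have hmono : ∀ v, potential (load x l v) ≤ potential (load x (s(u, w) :: l) v) := fun v =>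
      potential_mono (hm0 v) (load_le_load_cons hx _ _ _)
    have hstep_u : potential (load x l u) + rate l s(u, w) * potential (load x l w) ≤
        potential (load x (s(u, w) :: l) u) := by
      simp only [load, Sym2.mem_iff, true_or, if_true]
      exact potential_add (hm0 u) (hm0 w) (hx _) (h0 _ _) (hr l u w hl).1 (hm1 u) (hm1 w)
    have hstep_w : potential (load x l w) + rate l s(u, w) * potential (load x l u) ≤
        potential (load x (s(u, w) :: l) w) := by
      simp only [load, Sym2.mem_iff, or_true, if_true]
      refine potential_add (hm0 w) (hm0 u) (hx _) (h0 _ _) ?_ (hm1 w) (hm1 u)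
      rw [mul_comm (accept _)]
      exact (hr l u w hl).1
    have hsymm : ∀ (l : List (Sym2 V)) (a b : V), pairBound ε x l a b = pairBound ε x l b a := by
      intro l a b
      rw [pairBound, pairBound, Sym2.eq_swap, mul_comm (potential _)]
    have hspread : ∀ p q b : V, b ≠ p → b ≠ q → s(u, w) = s(p, q) →
        potential (load x l p) + rate l s(u, w) * potential (load x l q) ≤
          potential (load x (s(u, w) :: l) p) →
        pairBound ε x l p b + rate l s(u, w) * pairBound ε x l q b ≤
          pairBound ε x (s(u, w) :: l) p b := by
      intro p q b hbp hbq hpq h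
      have hiff : (s(p, b) ∈ s(u, w) :: l) ↔ s(p, b) ∈ l := by
        rw [List.mem_cons, or_iff_right]
        rw [hpq, Sym2.eq_iff]
        rintro (⟨_, h⟩ | ⟨_, h⟩)
        · exact hbq h
        · exact hbp h
      simp only [pairBound, hiff]
      have hb := hP1 b
      have hy := h0 l s(u, w)
      have h3 := mul_le_mul_of_nonneg_right h (zero_le_one.trans hb)
      have h4 := mul_le_mul_of_nonneg_left (hmono b)
        (zero_le_one.trans ((hP1 p).trans (hmono p)))
      have h5 : (0 : ℝ) ≤ rate l s(u, w) * if s(q, b) ∈ l then 0 else 1 := by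
        split_ifs <;> simp [hy]
      have h6 := mul_le_mul_of_nonneg_left (sub_nonneg.2 (add_le_add h3 (add_le_add h4 h5)))
        hε0
      nlinarith
    refine (ih hl').step h0 h1 ?_ (fun b hbu hbw => hspread u w b hbu hbw rfl hstep_u)
      (fun b hbu hbw => hspread w u b hbw hbu Sym2.eq_swap hstep_w) ?_ (hsymm _) (hsymm _)
    · intro a b
      have hind : (if s(a, b) ∈ s(u, w) :: l then (0 : ℝ) else 1) ≤
          if s(a, b) ∈ l then 0 else 1 := by
        by_cases h : s(a, b) ∈ l
        · simp [h]
        · simp only [h, if_false]; split_ifs <;> simp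
      have := mul_le_mul (hmono a) (hmono b) (zero_le_one.trans (hP1 b))
        (zero_le_one.trans ((hP1 a).trans (hmono a)))
      unfold pairBound
      gcongr
    · have := mul_le_mul (hmono u) (hmono w) (zero_le_one.trans (hP1 w))
        (zero_le_one.trans ((hP1 u).trans (hmono u)))
      have hy : rate l s(u, w) ≤ ε := by
        refine ((hr l u w hl).1.trans ?_).trans (hε s(u, w))
        exact mul_le_of_le_one_right (hx _) (mul_le_one₀ (accept_le_one (hm1 u))
          (accept_nonneg (hm1 w)) (accept_le_one (hm1 w)))
      simp only [pairBound, hnot, List.mem_cons, true_or, if_true, if_false]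
      nlinarith

lemma chainE_free_cons_left (l : List (Sym2 V)) (u w : V) :
    chainE rate (s(u, w) :: l) (free u) = chainE rate l (free u) -
      rate l s(u, w) * chainE rate l (fun s => free u s * free w s) := by
  have h : ∀ s, free u (matchUp s(u, w) s) = free u s - free u s * free w s := by
    intro s
    simp only [free, matchUp_apply_mk]
    cases s u <;> cases s w <;> simp
  simp only [chainE, h]
  rw [chainE_sub]
  ring

lemma chainE_free_cons_of_not_mem {l : List (Sym2 V)} {e : Sym2 V} {v : V} (hv : v ∉ e) :
    chainE rate (e :: l) (free v) = chainE rate l (free v) := by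
  have h : ∀ s, free v (matchUp e s) = free v s := fun s => by simp [free, matchUp, hv]
  simp only [chainE, h]
  ring

lemma abs_cov_free_le (h0 : ∀ l e, 0 ≤ rate l e) (h1 : ∀ l e, rate l e ≤ 1)
    (hx : ∀ e, 0 ≤ x e) (hε : ∀ e, x e ≤ ε) (hε0 : 0 ≤ ε) (hr : NearIdeal x δ rate)
    {l : List (Sym2 V)} (hl : Admissible x l) {u w : V} (huw : u ≠ w) :
    |chainE rate l (fun s => free u s * free w s) -
      chainE rate l (free u) * chainE rate l (free w)| ≤ 170 * ε := by
  have h := covBound_pairBound h0 h1 hx hε hε0 hr hl {u} {w} (free u) (free w) (by simpa)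
    (dependsOn_free u) (dependsOn_free w) (abs_free_le u) (abs_free_le w)
  simp only [Finset.sum_singleton] at h
  refine h.trans ?_
  -- `2 / α < 5.3`, and `6 * 5.3 ^ 2 < 170`
  have hm0 := load_nonneg hx l
  have hα := goldenAlpha_gt
  have hP : ∀ v, potential (load x l v) ≤ 5.3 := fun v =>
    (potential_le (hm0 v) (hl.2.2 v)).trans (by rw [div_le_iff₀ (by linarith)]; linarith)
  have := mul_le_mul (hP u) (hP w) (zero_le_one.trans (one_le_potential (hm0 w))) (by norm_num)
  have hi : (0 : ℝ) ≤ if s(u, w) ∈ l then 0 else 1 := by split_ifs <;> simp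
  unfold pairBound
  nlinarith

/-- The error in the probability that a vertex is free contracts by the factor `1 - α` along each
edge, because an endpoint that is free with probability `g` makes the rate at most
`x * (1 - α) / g`. -/
lemma abs_chainE_free_sub_le (h0 : ∀ l e, 0 ≤ rate l e) (h1 : ∀ l e, rate l e ≤ 1)
    (hx : ∀ e, 0 ≤ x e) (hε : ∀ e, x e ≤ ε) (hε0 : 0 ≤ ε) (hδ : 0 ≤ δ) (hr : NearIdeal x δ rate)
    {l : List (Sym2 V)} (hl : Admissible x l) (v : V) :
    |chainE rate l (free v) - (1 - α * load x l v)| ≤ (170 * ε + δ) / α * load x l v := by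
  induction l generalizing v with
  | nil => simp [chainE, free, load]
  | cons e l ih =>
    have hl' := hl.of_cons hx
    by_cases hv : v ∈ e
    swap
    · rw [chainE_free_cons_of_not_mem hv]
      simpa [load, hv] using ih hl' v
    obtain ⟨w, rfl⟩ := hv
    have hne : v ≠ w := fun h => hl.2.1 s(v, w) (by simp) (by simp [h])
    have hm0 := load_nonneg hx l
    have hm1 := hl'.2.2
    have ihv := ih hl' v
    have ihw := ih hl' w
    have hcov := abs_cov_free_le h0 h1 hx hε hε0 hr hl' hne
    obtain ⟨hr1, hr2⟩ := hr l v w hl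
    have hxe := hx s(v, w)
    have hy0 := h0 l s(v, w)
    have hy1 := h1 l s(v, w)
    have hα := goldenAlpha_gt
    have hα' := goldenAlpha_lt
    have hα0 : (0 : ℝ) < α := by linarith
    have hgv := one_sub_le_one_sub_mul (hm1 v)
    have hgw := one_sub_le_one_sub_mul (hm1 w)
    have hav := accept_mul (hm1 v)
    have haw := accept_mul (hm1 w)
    have haw1 := accept_le_one (hm1 w)
    have hav1 := accept_le_one (hm1 v)
    have hav0 := accept_nonneg (hm1 v)
    have haw0 := accept_nonneg (hm1 w)
    have hE0 : 0 ≤ chainE rate l (free w) := by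
      rw [← chainE_const (rate := rate) l 0]
      exact chainE_mono h0 h1 l (free_nonneg w)
    have hE1 : chainE rate l (free w) ≤ 1 := (abs_le.1 (abs_chainE_le h0 h1 l (abs_free_le w))).2
    rw [chainE_free_cons_left]
    simp only [load, Sym2.mem_iff, true_or, if_true]
    set y := rate l s(v, w)
    set X := x s(v, w)
    set gv := 1 - α * load x l v with hgv_def
    set gw := 1 - α * load x l w with hgw_def
    set av := accept (load x l v)
    set aw := accept (load x l w)
    set mv := chainE rate l (free v)
    set mw := chainE rate l (free w)
    set F := chainE rate l (fun s => free v s * free w s)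
    set C := (170 * ε + δ) / α with hC
    have hC0 : 0 ≤ C := by positivity
    have hCα : C * α = 170 * ε + δ := div_mul_cancel₀ _ hα0.ne'
    have hideal : X * (av * aw) * (gv * gw) = X * α := by
      rw [goldenAlpha_eq]
      linear_combination X * (aw * gw) * hav + X * (1 - goldenAlpha) * haw
    have e1 : mv - y * F - (1 - α * (load x l v + X)) =
        (mv - gv) * (1 - y * mw) - y * gv * (mw - gw) - y * (F - mv * mw) +
          (X * (av * aw) - y) * (gv * gw) := by
      have : 1 - α * (load x l v + X) = gv - X * α := by rw [hgv_def]; ring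
      rw [this, ← hideal]; ring
    have hgv1 : gv ≤ 1 := by nlinarith [hm0 v]
    have hgw1 : gw ≤ 1 := by nlinarith [hm0 w]
    have t1 : |(mv - gv) * (1 - y * mw)| ≤ C * load x l v := by
      rw [abs_mul]
      refine (mul_le_of_le_one_right (abs_nonneg _) ?_).trans ihv
      have := mul_nonneg hy0 hE0
      have := mul_le_one₀ hy1 hE0 hE1
      rw [abs_le]; constructor <;> linarith
    have t2 : |y * gv * (mw - gw)| ≤ X * (1 - α) * C := by
      rw [abs_mul]
      have hw : |mw - gw| ≤ C := ihw.trans (mul_le_of_le_one_right hC0 (hm1 w))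
      have hygv : y * gv ≤ X * (1 - α) := by
        calc y * gv ≤ X * (av * aw) * gv := by gcongr; linarith
          _ = X * (1 - α) * aw := by rw [← hav]; ring
          _ ≤ X * (1 - α) := mul_le_of_le_one_right (mul_nonneg hxe (by linarith)) haw1
      rw [abs_of_nonneg (mul_nonneg hy0 (by linarith))]
      gcongr
      exact mul_nonneg hxe (by linarith)
    have hyX : y ≤ X := hr1.trans (mul_le_of_le_one_right hxe (mul_le_one₀ hav1 haw0 haw1))
    have t3 : |y * (F - mv * mw)| ≤ X * (170 * ε) := by
      rw [abs_mul, abs_of_nonneg hy0]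
      gcongr
    have t4 : |(X * (av * aw) - y) * (gv * gw)| ≤ X * δ := by
      have hgg : gv * gw ≤ 1 := mul_le_one₀ hgv1 (by linarith) hgw1
      have hgg0 : 0 ≤ gv * gw := mul_nonneg (by linarith) (by linarith)
      rw [abs_mul, abs_of_nonneg (sub_nonneg.2 hr1), abs_of_nonneg hgg0]
      refine (mul_le_of_le_one_right (sub_nonneg.2 hr1) hgg).trans ?_
      linarith
    rw [e1]
    have : C * (load x l v + X) = C * load x l v + X * (1 - α) * C + X * (170 * ε) + X * δ := by
      linear_combination X * hCα
    rw [this]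
    rw [abs_le] at t1 t2 t3 t4 ⊢
    constructor <;> linarith

/-- Every edge is selected with probability almost `α` times its value. -/
lemma rate_mul_chainE_free_ge (h0 : ∀ l e, 0 ≤ rate l e) (h1 : ∀ l e, rate l e ≤ 1)
    (hx : ∀ e, 0 ≤ x e) (hε : ∀ e, x e ≤ ε) (hε0 : 0 ≤ ε) (hδ : 0 ≤ δ) (hr : NearIdeal x δ rate)
    {l : List (Sym2 V)} {u w : V} (hl : Admissible x (s(u, w) :: l)) :
    x s(u, w) * (α - (1100 * ε + 7 * δ)) ≤
      rate l s(u, w) * chainE rate l (fun s => free u s * free w s) := by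
  have hl' := hl.of_cons hx
  have hne : u ≠ w := fun h => hl.2.1 s(u, w) (by simp) (by simp [h])
  have hm0 := load_nonneg hx l
  have hm1 := hl'.2.2
  have hcov := abs_cov_free_le h0 h1 hx hε hε0 hr hl' hne
  have hu := abs_chainE_free_sub_le h0 h1 hx hε hε0 hδ hr hl' u
  have hw := abs_chainE_free_sub_le h0 h1 hx hε hε0 hδ hr hl' w
  obtain ⟨hr1, hr2⟩ := hr l u w hl
  have hxe := hx s(u, w)
  have hy0 := h0 l s(u, w)
  have hα := goldenAlpha_gt
  have hα' := goldenAlpha_lt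
  have hα0 : (0 : ℝ) < α := by linarith
  have hgu := one_sub_le_one_sub_mul (hm1 u)
  have hgw := one_sub_le_one_sub_mul (hm1 w)
  have hau := accept_mul (hm1 u)
  have haw := accept_mul (hm1 w)
  have hau1 := accept_le_one (hm1 u)
  have haw1 := accept_le_one (hm1 w)
  have haw0 := accept_nonneg (hm1 w)
  have hE1 : |chainE rate l (free w)| ≤ 1 := abs_chainE_le h0 h1 l (abs_free_le w)
  have hC : (170 * ε + δ) / α ≤ 2.7 * (170 * ε + δ) := by
    rw [div_le_iff₀ hα0]; nlinarith
  have hC0 : 0 ≤ (170 * ε + δ) / α := by positivity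
  have hu' := hu.trans ((mul_le_of_le_one_right hC0 (hm1 u)).trans hC)
  have hw' := hw.trans ((mul_le_of_le_one_right hC0 (hm1 w)).trans hC)
  have hgu0 : |1 - α * load x l u| ≤ 1 := by
    rw [abs_of_nonneg (by linarith)]
    nlinarith [hm0 u]
  have hgu1 : 1 - α * load x l u ≤ 1 := (abs_le.1 hgu0).2
  have hgw1 : 1 - α * load x l w ≤ 1 := by nlinarith [hm0 w]
  set y := rate l s(u, w)
  set X := x s(u, w)
  set gu := 1 - α * load x l u with hgu_def
  set gw := 1 - α * load x l w with hgw_def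
  set au := accept (load x l u)
  set aw := accept (load x l w)
  set mu := chainE rate l (free u)
  set mw := chainE rate l (free w)
  set F := chainE rate l (fun s => free u s * free w s)
  have hideal : X * (au * aw) * (gu * gw) = X * α := by
    rw [goldenAlpha_eq]
    linear_combination X * (aw * gw) * hau + X * (1 - goldenAlpha) * haw
  have hyX : y ≤ X := hr1.trans (mul_le_of_le_one_right hxe (mul_le_one₀ hau1 haw0 haw1))
  have e1 : F = (F - mu * mw) + (mu - gu) * mw + gu * (mw - gw) + gu * gw := by ring
  have t1 : |(mu - gu) * mw| ≤ 2.7 * (170 * ε + δ) := by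
    rw [abs_mul]; exact (mul_le_of_le_one_right (abs_nonneg _) hE1).trans hu'
  have t2 : |gu * (mw - gw)| ≤ 2.7 * (170 * ε + δ) := by
    rw [abs_mul]; exact (mul_le_of_le_one_left (abs_nonneg _) hgu0).trans hw'
  have hF : gu * gw - (1090 * ε + 5.4 * δ) ≤ F := by
    rw [e1]
    have := (abs_le.1 t1).1
    have := (abs_le.1 t2).1
    have := (abs_le.1 hcov).1
    linarith
  have hgg : gu * gw ≤ 1 := mul_le_one₀ hgu1 (by linarith) hgw1
  have hgg0 : 0 ≤ gu * gw := mul_nonneg (by linarith) (by linarith)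
  have i1 : X * α - X * δ ≤ y * (gu * gw) := by
    have := mul_le_mul_of_nonneg_right hr2 hgg0
    have := mul_le_of_le_one_right (mul_nonneg hxe hδ) hgg
    rw [← hideal]
    linarith
  have i2 := mul_le_mul_of_nonneg_left hF hy0
  have i3 : y * (1090 * ε + 5.4 * δ) ≤ X * (1090 * ε + 5.4 * δ) := by gcongr
  have i4 : 0 ≤ X * ε := mul_nonneg hxe hε0
  have i5 : 0 ≤ X * δ := mul_nonneg hxe hδ
  linarith

end Analysis

/-! ### Coins made of fair bits -/

section Bits

/-- The stream `R` without its first `m` bits. -/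
def dropBits (m : ℕ) (R : ℕ → Bool) : ℕ → Bool := fun i => R (i + m)

/-- The stream that starts with `b` and continues with `R`. -/
def consBit (b : Bool) (R : ℕ → Bool) : ℕ → Bool
  | 0 => b
  | i + 1 => R i

@[simp] lemma consBit_zero (b : Bool) (R : ℕ → Bool) : consBit b R 0 = b := rfl

@[simp] lemma dropBits_zero (R : ℕ → Bool) : dropBits 0 R = R := rfl

@[simp] lemma dropBits_one_consBit (b : Bool) (R : ℕ → Bool) : dropBits 1 (consBit b R) = R := rfl

lemma dropBits_succ_consBit (m : ℕ) (b : Bool) (R : ℕ → Bool) :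
    dropBits (m + 1) (consBit b R) = dropBits m R := rfl

lemma dropBits_dropBits (m k : ℕ) (R : ℕ → Bool) :
    dropBits m (dropBits k R) = dropBits (m + k) R := by
  funext i; simp [dropBits, add_assoc]

/-- The expectation of `g` over `N` fair bits, followed by zeros. -/
noncomputable def bitE : ℕ → ((ℕ → Bool) → ℝ) → ℝ
  | 0, g => g fun _ => false
  | N + 1, g => (bitE N (fun R => g (consBit false R)) + bitE N (fun R => g (consBit true R))) / 2

/-- `g` depends only on the first `m` bits. -/
def UsesBits {β : Type*} (m : ℕ) (g : (ℕ → Bool) → β) : Prop :=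
  ∀ R R', (∀ i < m, R i = R' i) → g R = g R'

lemma UsesBits.consBit {β : Type*} {m : ℕ} {g : (ℕ → Bool) → β} (h : UsesBits (m + 1) g)
    (b : Bool) : UsesBits m fun R => g (consBit b R) := by
  intro R R' hR
  apply h
  rintro (_ | i) hi
  · rfl
  · exact hR i (by omega)

lemma UsesBits.mono {β : Type*} {m k : ℕ} {g : (ℕ → Bool) → β} (h : UsesBits m g) (hk : m ≤ k) :
    UsesBits k g := fun R R' hR => h R R' fun i hi => hR i (hi.trans_le hk)

lemma UsesBits.comp_dropBits {β : Type*} {m : ℕ} {g : (ℕ → Bool) → β} (h : UsesBits m g) (k : ℕ) :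
    UsesBits (k + m) fun R => g (dropBits k R) := fun R R' hR =>
  h _ _ fun i hi => hR (i + k) (by omega)

lemma UsesBits.map {β γ : Type*} {m : ℕ} {g : (ℕ → Bool) → β} (h : UsesBits m g) (f : β → γ) :
    UsesBits m fun R => f (g R) := fun R R' hR => congrArg f (h R R' hR)

lemma UsesBits.map₂ {β γ δ : Type*} {m : ℕ} {g : (ℕ → Bool) → β} {g' : (ℕ → Bool) → γ}
    (h : UsesBits m g) (h' : UsesBits m g') (f : β → γ → δ) :
    UsesBits m fun R => f (g R) (g' R) := fun R R' hR => congrArg₂ f (h R R' hR) (h' R R' hR)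

lemma bitE_add (N : ℕ) (g h : (ℕ → Bool) → ℝ) :
    bitE N (fun R => g R + h R) = bitE N g + bitE N h := by
  induction N generalizing g h with
  | zero => rfl
  | succ N ih =>
    simp only [bitE]
    rw [ih (fun R => g (consBit false R)), ih (fun R => g (consBit true R))]
    ring

lemma bitE_const (N : ℕ) (c : ℝ) : bitE N (fun _ => c) = c := by
  induction N with
  | zero => rfl
  | succ N ih => simp only [bitE]; rw [ih]; ring

lemma bitE_const_mul (N : ℕ) (c : ℝ) (g : (ℕ → Bool) → ℝ) :
    bitE N (fun R => c * g R) = c * bitE N g := by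
  induction N generalizing g with
  | zero => rfl
  | succ N ih =>
    simp only [bitE]
    rw [ih (fun R => g (consBit false R)), ih (fun R => g (consBit true R))]
    ring

lemma bitE_sub (N : ℕ) (g h : (ℕ → Bool) → ℝ) :
    bitE N (fun R => g R - h R) = bitE N g - bitE N h := by
  have e := bitE_add N g fun R => (-1) * h R
  rw [bitE_const_mul] at e
  rw [sub_eq_add_neg, ← neg_one_mul, ← e]
  congr 1; ext R; ring

/-- Disjoint blocks of bits are independent. -/
lemma bitE_mul {a b : ℕ} {c : (ℕ → Bool) → ℝ} (hc : UsesBits a c) (g : (ℕ → Bool) → ℝ) :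
    bitE (a + b) (fun R => c R * g (dropBits a R)) = bitE a c * bitE b g := by
  induction a generalizing c with
  | zero =>
    have : ∀ R, c R = c fun _ => false := fun R => hc _ _ (by simp)
    simp only [this, dropBits_zero, zero_add, bitE_const_mul, bitE]
  | succ a ih =>
    rw [Nat.add_right_comm]
    simp only [bitE, dropBits_succ_consBit]
    rw [ih (hc.consBit false), ih (hc.consBit true)]
    ring

lemma bitE_of_usesBits {a : ℕ} (b : ℕ) {c : (ℕ → Bool) → ℝ} (hc : UsesBits a c) :
    bitE (a + b) c = bitE a c := by
  simpa [bitE_const] using bitE_mul (b := b) hc fun _ => 1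

/-- Extend a finite bit string by zeros. -/
def padBits {N : ℕ} (R : Fin N → Bool) : ℕ → Bool :=
  fun i => if h : i < N then R ⟨i, h⟩ else false

lemma padBits_cons {N : ℕ} (b : Bool) (R : Fin N → Bool) :
    padBits (Fin.cons b R : Fin (N + 1) → Bool) = consBit b (padBits R) := by
  funext i
  cases i with
  | zero => simp [padBits]
  | succ i =>
    simp only [padBits, consBit, Nat.add_lt_add_iff_right]
    split_ifs
    · exact Fin.cons_succ (α := fun _ => Bool) b R ⟨i, by assumption⟩
    · rfl

lemma bitE_eq_sum (N : ℕ) (g : (ℕ → Bool) → ℝ) :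
    bitE N g = (∑ R : Fin N → Bool, g (padBits R)) / 2 ^ N := by
  induction N generalizing g with
  | zero =>
    have : ∀ R : Fin 0 → Bool, padBits R = fun _ => false := fun R => by
      funext i; simp [padBits]
    simp [bitE, this]
  | succ N ih =>
    have e := (Fin.consEquiv fun _ : Fin (N + 1) => Bool).sum_comp fun R => g (padBits R)
    rw [← e, Fintype.sum_prod_type]
    have h : ∀ b (R : Fin N → Bool), padBits ((Fin.consEquiv fun _ => Bool) (b, R)) =
        consBit b (padBits R) := padBits_cons
    simp only [h, Fintype.sum_bool, bitE, ih]
    rw [pow_succ]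
    field_simp
    ring

end Bits

/-! ### Walk coins and geometric coins -/

section Coins

/-- The position after `k` steps of the walk that starts at `p`, goes up by `2` or down by `1`
according to the next bit, and is absorbed at `0`. -/
def walk : ℕ → ℕ → (ℕ → Bool) → ℕ
  | 0, p, _ => p
  | k + 1, p, R => walk k (if p = 0 then 0 else p - 1 + 3 * (R 0).toNat) (dropBits 1 R)

/-- The number read from `k` bits, most significant first, continuing from `v`. -/
def readNum : ℕ → ℕ → (ℕ → Bool) → ℕ
  | 0, v, _ => v
  | k + 1, v, R => readNum k (2 * v + (R 0).toNat) (dropBits 1 R)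

/-- The geometric coin with at most `j` rounds: a round accepts at once if the walk from `1` is
absorbed, goes on to the next round if moreover a uniform `K`-bit number lies below `Z`, and
rejects otherwise. As `K` and `j` grow, the probability `a` of acceptance approaches the solution
of `a = (1 - α) + α * (Z / 2 ^ K) * a`. -/
def coin (K Z : ℕ) : ℕ → (ℕ → Bool) → Bool
  | 0, _ => false
  | j + 1, R => walk K 1 R == 0 ||
      (Nat.blt (readNum K 0 (dropBits K R)) Z && coin K Z j (dropBits (2 * K) R))

/-- Two independent geometric coins, one for each endpoint of an edge. -/
def twoCoins (K Z₁ Z₂ : ℕ) (R : ℕ → Bool) : Bool :=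
  coin K Z₁ K R && coin K Z₂ K (dropBits (2 * K * K) R)

lemma usesBits_walk (k p : ℕ) : UsesBits k (walk k p) := by
  induction k generalizing p with
  | zero => intro R R' _; rfl
  | succ k ih =>
    intro R R' h
    simp only [walk]
    rw [h 0 (by omega)]
    exact ih _ _ _ fun i hi => h (i + 1) (by omega)

lemma usesBits_readNum (k v : ℕ) : UsesBits k (readNum k v) := by
  induction k generalizing v with
  | zero => intro R R' _; rfl
  | succ k ih =>
    intro R R' h
    simp only [readNum]
    rw [h 0 (by omega)]
    exact ih _ _ _ fun i hi => h (i + 1) (by omega)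

lemma usesBits_coin (K Z j : ℕ) : UsesBits (2 * K * j) (coin K Z j) := by
  induction j with
  | zero => intro R R' _; rfl
  | succ j ih =>
    intro R R' h
    rw [Nat.mul_succ] at h
    simp only [coin]
    have e1 : readNum K 0 (dropBits K R) = readNum K 0 (dropBits K R') :=
      (usesBits_readNum K 0).comp_dropBits K R R' fun i hi => h i (by omega)
    have e2 : coin K Z j (dropBits (2 * K) R) = coin K Z j (dropBits (2 * K) R') :=
      ih.comp_dropBits (2 * K) R R' fun i hi => h i (by omega)
    rw [usesBits_walk K 1 R R' fun i hi => h i (by omega), e1, e2]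

lemma usesBits_twoCoins (K Z₁ Z₂ : ℕ) : UsesBits (2 * (2 * K * K)) (twoCoins K Z₁ Z₂) := by
  intro R R' h
  simp only [twoCoins]
  have e : coin K Z₂ K (dropBits (2 * K * K) R) = coin K Z₂ K (dropBits (2 * K * K) R') :=
    (usesBits_coin K Z₂ K).comp_dropBits _ R R' fun i hi => h i (by omega)
  rw [usesBits_coin K Z₁ K R R' fun i hi => h i (by omega), e]

/-- The indicator of a Boolean. -/
def ind (b : Bool) : ℝ := if b then 1 else 0

lemma ind_and (a b : Bool) : ind (a && b) = ind a * ind b := by cases a <;> cases b <;> simp [ind]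

lemma ind_or_and (a b c : Bool) : ind (a || (b && c)) = ind a + (1 - ind a) * ind b * ind c := by
  cases a <;> cases b <;> cases c <;> simp [ind]

/-- The probability that the walk from `p` is absorbed within `k` steps. -/
noncomputable def walkProb (k p : ℕ) : ℝ := bitE k fun R => ind (walk k p R == 0)

lemma walkProb_succ_zero (k : ℕ) : walkProb (k + 1) 0 = walkProb k 0 := by
  simp [walkProb, bitE, walk]

lemma walkProb_succ_succ (k p : ℕ) :
    walkProb (k + 1) (p + 1) = (walkProb k p + walkProb k (p + 3)) / 2 := by
  simp [walkProb, bitE, walk]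

local notation "α" => goldenAlpha

/-- `p ↦ (1 - α) ^ p` is harmonic for the walk, since `1 - α` is a root of `t ^ 3 - 2 t + 1`. -/
lemma one_sub_goldenAlpha_harmonic (p : ℕ) :
    ((1 - α) ^ p + (1 - α) ^ (p + 3)) / 2 = (1 - α) ^ (p + 1) := by
  have h := goldenAlpha_eq
  have : (1 - α) ^ 3 = 1 - 2 * α := by
    calc (1 - α) ^ 3 = (1 - α) * (1 - α) ^ 2 := by ring
      _ = (1 - α) * α := by rw [← h]
      _ = 1 - 2 * α := by linear_combination h
  rw [pow_add, pow_add, this]; ring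

lemma walkProb_zero_left (p : ℕ) : walkProb 0 p = if p = 0 then 1 else 0 := by
  cases p <;> simp [walkProb, bitE, walk, ind]

lemma walkProb_zero_right (k : ℕ) : walkProb k 0 = 1 := by
  induction k with
  | zero => simp [walkProb_zero_left]
  | succ k ih => rw [walkProb_succ_zero, ih]

lemma walkProb_le (k p : ℕ) : walkProb k p ≤ (1 - α) ^ p := by
  have hα := goldenAlpha_lt
  induction k generalizing p with
  | zero =>
    rw [walkProb_zero_left]
    split_ifs with h
    · simp [h]
    · exact pow_nonneg (by linarith) _
  | succ k ih =>
    cases p with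
    | zero => rw [walkProb_succ_zero]; exact ih 0
    | succ p =>
      rw [walkProb_succ_succ, ← one_sub_goldenAlpha_harmonic]
      linarith [ih p, ih (p + 3)]

/-- The factor `0.9606` bounds the expected growth of `0.9 ^ position` in a step, so that
`(1 - α) ^ p - 0.9606 ^ k * 0.9 ^ p` is subharmonic. -/
lemma le_walkProb (k p : ℕ) : (1 - α) ^ p - 0.9606 ^ k * 0.9 ^ p ≤ walkProb k p := by
  have hα := goldenAlpha_lt
  have hα' := goldenAlpha_gt
  induction k generalizing p with
  | zero =>
    rw [walkProb_zero_left]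
    split_ifs with h
    · simp [h]
    · have := pow_le_pow_left₀ (by linarith : (0 : ℝ) ≤ 1 - α) (by linarith : 1 - α ≤ 0.9) p
      simpa using this
  | succ k ih =>
    cases p with
    | zero =>
      rw [walkProb_zero_right, pow_zero, pow_zero]
      have : (0 : ℝ) < 0.9606 ^ (k + 1) := by positivity
      linarith
    | succ p =>
      rw [walkProb_succ_succ, ← one_sub_goldenAlpha_harmonic]
      have h1 := ih p
      have h2 := ih (p + 3)
      have h3 : (0 : ℝ) < 0.9606 ^ k * 0.9 ^ p := by positivity
      rw [pow_succ (0.9606 : ℝ), pow_succ (0.9 : ℝ)]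
      rw [pow_add (0.9 : ℝ)] at h2
      nlinarith

lemma walkProb_nonneg (k p : ℕ) : 0 ≤ walkProb k p := by
  induction k generalizing p with
  | zero => rw [walkProb_zero_left]; split_ifs <;> simp
  | succ k ih =>
    cases p with
    | zero => rw [walkProb_succ_zero]; exact ih 0
    | succ p => rw [walkProb_succ_succ]; have := ih p; have := ih (p + 3); positivity

lemma bitE_readNum_lt (k v Z : ℕ) :
    bitE k (fun R => ind (Nat.blt (readNum k v R) Z)) =
      ((min (2 ^ k) (Z - 2 ^ k * v) : ℕ) : ℝ) / 2 ^ k := by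
  induction k generalizing v with
  | zero =>
    simp only [bitE, readNum, ind, Nat.blt_eq, pow_zero, one_mul, div_one]
    by_cases h : v < Z
    · rw [if_pos h, min_eq_left (by omega)]; simp
    · rw [if_neg h, Nat.sub_eq_zero_of_le (by omega)]; simp
  | succ k ih =>
    simp only [bitE, readNum, consBit_zero, dropBits_one_consBit, ih]
    have e : min (2 ^ (k + 1)) (Z - 2 ^ (k + 1) * v) =
        min (2 ^ k) (Z - 2 ^ k * (2 * v + false.toNat)) +
          min (2 ^ k) (Z - 2 ^ k * (2 * v + true.toNat)) := by
      have h1 : 2 ^ (k + 1) * v = 2 * (2 ^ k * v) := by ring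
      have h2 : 2 ^ k * (2 * v + false.toNat) = 2 * (2 ^ k * v) := by simp; ring
      have h3 : 2 ^ k * (2 * v + true.toNat) = 2 * (2 ^ k * v) + 2 ^ k := by simp; ring
      rw [h1, h2, h3, pow_succ]
      omega
    rw [e, pow_succ]
    push_cast
    field_simp

/-- The probability that a uniform `K`-bit number lies below `Z`. -/
noncomputable def fracBelow (K Z : ℕ) : ℝ := ((min (2 ^ K) Z : ℕ) : ℝ) / 2 ^ K

lemma fracBelow_nonneg (K Z : ℕ) : 0 ≤ fracBelow K Z := by unfold fracBelow; positivity

lemma fracBelow_le_one (K Z : ℕ) : fracBelow K Z ≤ 1 := by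
  unfold fracBelow
  rw [div_le_one (by positivity)]
  exact_mod_cast min_le_left _ _

/-- The probability that the geometric coin with `j` rounds accepts. -/
noncomputable def coinProb (K Z : ℕ) : ℕ → ℝ
  | 0 => 0
  | j + 1 => walkProb K 1 + (1 - walkProb K 1) * fracBelow K Z * coinProb K Z j

lemma bitE_coin (K Z j : ℕ) : bitE (2 * K * j) (fun R => ind (coin K Z j R)) = coinProb K Z j := by
  induction j with
  | zero => simp [bitE, coin, coinProb, ind]
  | succ j ih =>
    have hw : UsesBits K fun R => ind (walk K 1 R == 0) :=
      (usesBits_walk K 1).map fun p => ind (p == 0)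
    have hw' : UsesBits K fun R => 1 - ind (walk K 1 R == 0) := hw.map fun p => 1 - p
    have hr : UsesBits K fun R => ind (Nat.blt (readNum K 0 R) Z) :=
      (usesBits_readNum K 0).map fun p => ind (Nat.blt p Z)
    have hwr : UsesBits (2 * K) fun R => (1 - ind (walk K 1 R == 0)) *
        ind (Nat.blt (readNum K 0 (dropBits K R)) Z) :=
      two_mul K ▸ (hw'.mono (by omega)).map₂ (hr.comp_dropBits K) (· * ·)
    have e1 : bitE (2 * K) (fun R => (1 - ind (walk K 1 R == 0)) *
        ind (Nat.blt (readNum K 0 (dropBits K R)) Z)) =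
          (1 - walkProb K 1) * fracBelow K Z := by
      rw [two_mul, bitE_mul hw' fun R => ind (Nat.blt (readNum K 0 R) Z), bitE_readNum_lt,
        bitE_sub, bitE_const]
      simp [walkProb, fracBelow]
    simp only [coin, coinProb, ind_or_and]
    rw [bitE_add, Nat.mul_succ, Nat.add_comm, bitE_mul hwr fun R => ind (coin K Z j R), e1, ih,
      two_mul, add_assoc, bitE_of_usesBits _ hw]
    rfl

lemma bitE_twoCoins (K Z₁ Z₂ : ℕ) : bitE (2 * (2 * K * K)) (fun R => ind (twoCoins K Z₁ Z₂ R)) =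
    coinProb K Z₁ K * coinProb K Z₂ K := by
  have hc : UsesBits (2 * K * K) fun R => ind (coin K Z₁ K R) := (usesBits_coin K Z₁ K).map ind
  simp only [twoCoins, ind_and]
  rw [two_mul (2 * K * K), bitE_mul hc fun R => ind (coin K Z₂ K R), bitE_coin, bitE_coin]

lemma walkProb_one_le (k : ℕ) : walkProb k 1 ≤ 1 - α := by simpa using walkProb_le k 1

lemma coinProb_nonneg (K Z j : ℕ) : 0 ≤ coinProb K Z j := by
  have := goldenAlpha_gt
  have := walkProb_one_le K
  have := walkProb_nonneg K 1
  have := fracBelow_nonneg K Z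
  induction j with
  | zero => exact le_rfl
  | succ j ih =>
    have : 0 ≤ 1 - walkProb K 1 := by linarith
    simp only [coinProb]; positivity

lemma coinProb_le_one (K Z j : ℕ) : coinProb K Z j ≤ 1 := by
  have := goldenAlpha_gt
  have h1 := walkProb_one_le K
  have h2 := fracBelow_nonneg K Z
  have h3 := fracBelow_le_one K Z
  induction j with
  | zero => exact zero_le_one
  | succ j ih =>
    have h4 := mul_le_one₀ h3 (coinProb_nonneg K Z j) ih
    have : 0 ≤ 1 - walkProb K 1 := by linarith
    simp only [coinProb]
    nlinarith

lemma coinProb_le_accept {K Z : ℕ} {s : ℝ} (hs1 : s ≤ 1) (hZ : (Z : ℝ) / 2 ^ K ≤ s) (j : ℕ) :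
    coinProb K Z j ≤ accept s := by
  have hα := goldenAlpha_gt
  have h1 := walkProb_one_le K
  have h2 := fracBelow_nonneg K Z
  have h3 : fracBelow K Z ≤ s := le_trans (by unfold fracBelow; gcongr; exact min_le_right _ _) hZ
  have hm := accept_mul hs1
  have ha := accept_nonneg hs1
  induction j with
  | zero => exact ha
  | succ j ih =>
    have h4 := coinProb_nonneg K Z j
    have h5 := mul_le_one₀ (fracBelow_le_one K Z) h4 (coinProb_le_one K Z j)
    have h6 : fracBelow K Z * coinProb K Z j ≤ s * accept s := by
      gcongr
      exact h2.trans h3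
    simp only [coinProb]
    nlinarith

/-- The three sources of error: precision `d` of the load, truncation of the walk, and truncation
of the number of rounds. -/
lemma accept_sub_coinProb_le {K Z : ℕ} {s d : ℝ} (hs1 : s ≤ 1)
    (hZ : (Z : ℝ) / 2 ^ K ≤ s) (hd : s - d ≤ (Z : ℝ) / 2 ^ K) (j : ℕ) :
    accept s - coinProb K Z j ≤ α ^ j + (d + 2 * 0.9606 ^ K) := by
  have hα := goldenAlpha_gt
  have hα' := goldenAlpha_lt
  have hb := walkProb_one_le K
  have hb' : 1 - α - 0.9606 ^ K * 0.9 ≤ walkProb K 1 := by simpa using le_walkProb K 1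
  have hγ : (0 : ℝ) < 0.9606 ^ K := by positivity
  have hz0 := fracBelow_nonneg K Z
  have hz1 := fracBelow_le_one K Z
  have hz : s - d ≤ fracBelow K Z := by
    have h2 : (0 : ℝ) < 2 ^ K := by positivity
    have : (Z : ℝ) ≤ 2 ^ K := by
      rw [div_le_iff₀ h2] at hZ; nlinarith
    unfold fracBelow
    rwa [min_eq_right (by exact_mod_cast this)]
  have hzs : fracBelow K Z ≤ s :=
    le_trans (by unfold fracBelow; gcongr; exact min_le_right _ _) hZ
  have hd0 : 0 ≤ d := by linarith
  have hm := accept_mul hs1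
  have ha0 := accept_nonneg hs1
  have ha1 := accept_le_one hs1
  induction j with
  | zero => simp only [coinProb, pow_zero]; linarith
  | succ j ih =>
    have hc0 := coinProb_nonneg K Z j
    have hc1 := coinProb_le_one K Z j
    have hca := coinProb_le_accept hs1 hZ j
    simp only [coinProb, pow_succ]
    set a := accept s
    set c := coinProb K Z j
    set z := fracBelow K Z
    set b := walkProb K 1
    have hzc : z * c ≤ 1 := mul_le_one₀ hz1 hc0 hc1
    have hzc0 : 0 ≤ z * c := mul_nonneg hz0 hc0
    have e : a - (b + (1 - b) * z * c) =
        α * ((s - z) * a) + α * (z * (a - c)) + (1 - α - b) * (1 - z * c) := by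
      linear_combination hm
    have t1 : (s - z) * a ≤ d := (mul_le_of_le_one_right (by linarith) ha1).trans (by linarith)
    have t2 : z * (a - c) ≤ a - c := mul_le_of_le_one_left (by linarith) hz1
    have t3 : (1 - α - b) * (1 - z * c) ≤ 1 - α - b :=
      mul_le_of_le_one_right (by linarith) (by linarith)
    have t4 := mul_le_mul_of_nonneg_left (t2.trans ih) (by linarith : 0 ≤ α)
    have t5 := mul_le_mul_of_nonneg_left t1 (by linarith : 0 ≤ α)
    rw [e]
    nlinarith

end Coins

/-! ### The scheme on binary approximations of the edge values -/

section Scheme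

variable {n : ℕ}

/-- Whether the two coins of the edge `e` accept, if it arrives after the edges of `l` (most recent
first). The `i`-th arrival has its own block of `4 * K ^ 2` random bits. -/
noncomputable def accepts (z : Sym2 (Fin n) → ℕ) (K : ℕ) (R : ℕ → Bool) (l : List (Sym2 (Fin n)))
    (e : Sym2 (Fin n)) : Bool :=
  twoCoins K (load z l e.inf) (load z l e.sup) (dropBits (l.length * (2 * (2 * K * K))) R)

/-- The vertices matched by the scheme after a history, given with the most recent arrival
first. -/
noncomputable def taken (z : Sym2 (Fin n) → ℕ) (K : ℕ) (R : ℕ → Bool) :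
    History n → Fin n → Bool
  | [] => fun _ => false
  | (e, b) :: h =>
    if b && accepts z K R (h.map Prod.fst) e then matchUp e (taken z K R h) else taken z K R h

/-- Whether the scheme selects the most recent arrival of a history, given with the most recent
arrival first. -/
noncomputable def chooses (z : Sym2 (Fin n) → ℕ) (K : ℕ) (R : ℕ → Bool) : History n → Bool
  | [] => false
  | (e, b) :: h => b && accepts z K R (h.map Prod.fst) e &&
      (!taken z K R h e.inf && !taken z K R h e.sup)

lemma mk_inf_sup (e : Sym2 (Fin n)) : s(e.inf, e.sup) = e := by
  induction e with | _ u w =>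
  rcases le_total u w with h | h
  · simp [Sym2.inf, Sym2.sup, h]
  · simp [Sym2.inf, Sym2.sup, h, Sym2.eq_swap]

variable {z : Sym2 (Fin n) → ℕ} {K : ℕ} {R : ℕ → Bool}

/-- Matched vertices remain matched. -/
lemma taken_append {h : History n} (h' : History n) {v : Fin n} (hv : taken z K R h v = true) :
    taken z K R (h' ++ h) v = true := by
  induction h' with
  | nil => exact hv
  | cons a h' ih =>
    simp only [List.cons_append, taken]
    split_ifs
    · simp [matchUp, ih]
    · exact ih

lemma taken_of_chooses {e : Sym2 (Fin n)} {b : Bool} {h : History n}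
    (hc : chooses z K R ((e, b) :: h) = true) {v : Fin n} (hv : v ∈ e) :
    taken z K R ((e, b) :: h) v = true := by
  simp only [chooses, Bool.and_eq_true, Bool.not_eq_true'] at hc
  rw [taken, if_pos (by simp [hc.1])]
  have : ∀ w ∈ e, taken z K R h w = false := by
    intro w hw
    rw [← mk_inf_sup e, Sym2.mem_iff] at hw
    rcases hw with rfl | rfl
    · exact hc.2.1
    · exact hc.2.2
  simp only [matchUp, hv, decide_true, Bool.true_and, Bool.or_eq_true, decide_eq_true_eq]
  exact Or.inr this

lemma history_reverse (S : Finset (Sym2 (Fin n))) (l : List (Sym2 (Fin n))) (e : Sym2 (Fin n)) :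
    (history S (l ++ [e])).reverse = history S (e :: l.reverse) := by
  simp [history]

lemma mem_of_chooses_history {S : Finset (Sym2 (Fin n))} {l : List (Sym2 (Fin n))}
    {e : Sym2 (Fin n)} (hc : chooses z K R (history S (l ++ [e])).reverse = true) : e ∈ S := by
  rw [history_reverse] at hc
  simp only [history, List.map_cons, chooses, Bool.and_eq_true, decide_eq_true_eq] at hc
  exact hc.1.1

lemma not_chooses_of_chooses {S : Finset (Sym2 (Fin n))} {l m : List (Sym2 (Fin n))}
    {e f : Sym2 (Fin n)} (he : chooses z K R (history S (l ++ [e])).reverse = true)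
    (hlm : l ++ [e] <+: m) {v : Fin n} (hve : v ∈ e) (hvf : v ∈ f) :
    chooses z K R (history S (m ++ [f])).reverse = false := by
  obtain ⟨r, rfl⟩ := hlm
  have ht : taken z K R (history S (l ++ [e] ++ r)).reverse v = true := by
    have e1 : (history S (l ++ [e] ++ r)).reverse =
        (history S r).reverse ++ (history S (l ++ [e])).reverse := by simp [history]
    rw [e1]
    refine taken_append _ ?_
    rw [history_reverse] at he ⊢
    exact taken_of_chooses he hve
  by_contra hc
  rw [Bool.not_eq_false, history_reverse] at hc
  simp only [history, List.map_cons, chooses, Bool.and_eq_true, Bool.not_eq_true'] at hc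
  simp only [history, ← List.map_reverse] at ht
  rw [← mk_inf_sup f, Sym2.mem_iff] at hvf
  rcases hvf with rfl | rfl
  · rw [hc.2.1] at ht; exact Bool.false_ne_true ht
  · rw [hc.2.2] at ht; exact Bool.false_ne_true ht

lemma selected_valid {π : Policy n} {order : List (Sym2 (Fin n))} {S : Finset (Sym2 (Fin n))}
    (hπ : ∀ l e, l ++ [e] <+: order →
      π (history S (l ++ [e])) = chooses z K R (history S (l ++ [e])).reverse) :
    selected π order S ⊆ S ∧ IsMatching (selected π order S) := by
  constructor
  · rintro e ⟨l, hl, hc⟩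
    rw [hπ l e hl] at hc
    exact mem_of_chooses_history hc
  · rintro e ⟨l, hl, hc⟩ f ⟨m, hm, hd⟩ hne v ⟨hve, hvf⟩
    rw [hπ l e hl] at hc
    rw [hπ m f hm] at hd
    have hlen : l.length ≠ m.length := by
      intro h
      have := (List.prefix_of_prefix_length_le hl hm (by simp [h])).eq_of_length (by simp [h])
      exact hne (by simpa using List.append_inj_right' this rfl)
    rcases lt_or_gt_of_ne hlen with h | h
    · have hp : l ++ [e] <+: m :=
        List.prefix_of_prefix_length_le hl ((List.prefix_append m [f]).trans hm) (by simpa using h)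
      rw [not_chooses_of_chooses hc hp hve hvf] at hd
      exact Bool.false_ne_true hd
    · have hp : m ++ [f] <+: l :=
        List.prefix_of_prefix_length_le hm ((List.prefix_append l [e]).trans hl) (by simpa using h)
      rw [not_chooses_of_chooses hd hp hvf hve] at hc
      exact Bool.false_ne_true hc

end Scheme

/-! ### The set of matched vertices as a Markov chain -/

section Expectation

variable {n : ℕ}

/-- The probability that `S` is the set of active elements of `E`. -/
noncomputable def activeProb {T : Type*} [DecidableEq T] (x : T → ℝ) (E S : Finset T) : ℝ :=
  (∏ e ∈ S, x e) * ∏ e ∈ E \ S, (1 - x e)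

lemma sum_activeProb_mem {T : Type*} [DecidableEq T] (x : T → ℝ) {E : Finset T} {e : T}
    (he : e ∈ E) (G : Finset T → ℝ) (hG : ∀ S, e ∉ S → G (insert e S) = G S) :
    ∑ S ∈ E.powerset, activeProb x E S * (ind (decide (e ∈ S)) * G S) =
      x e * ∑ S ∈ E.powerset, activeProb x E S * G S := by
  rw [← Finset.insert_erase he]
  set E' := E.erase e
  have hE' : e ∉ E' := Finset.notMem_erase e E
  rw [Finset.sum_powerset_insert hE', Finset.sum_powerset_insert hE',
    ← Finset.sum_add_distrib, ← Finset.sum_add_distrib, Finset.mul_sum]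
  refine Finset.sum_congr rfl fun S hS => ?_
  have hS' : e ∉ S := fun h => hE' (Finset.mem_powerset.1 hS h)
  have h1 : insert e E' \ S = insert e (E' \ S) := by
    rw [Finset.insert_sdiff_of_notMem _ hS']
  have h2 : insert e E' \ insert e S = E' \ S := by
    rw [Finset.insert_sdiff_insert, Finset.sdiff_insert_of_notMem hE']
  have h3 : e ∉ E' \ S := fun h => hE' (Finset.mem_sdiff.1 h).1
  rw [hG S hS']
  simp only [activeProb, h1, h2, Finset.prod_insert h3, Finset.prod_insert hS', ind, hS',
    Finset.mem_insert_self, decide_true, decide_false, if_true]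
  simp
  ring

lemma sum_activeProb {T : Type*} [DecidableEq T] (x : T → ℝ) (E : Finset T) :
    ∑ S ∈ E.powerset, activeProb x E S = 1 := by
  simp only [activeProb]
  rw [← Finset.prod_add]
  simp

/-- The probability that `e` is active and accepted by its coins. -/
noncomputable def coinRate (x : Sym2 (Fin n) → ℝ) (z : Sym2 (Fin n) → ℕ) (K : ℕ)
    (l : List (Sym2 (Fin n))) (e : Sym2 (Fin n)) : ℝ :=
  x e * (coinProb K (load z l e.inf) K * coinProb K (load z l e.sup) K)

variable {z : Sym2 (Fin n) → ℕ} {K : ℕ}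

lemma usesBits_taken (h : History n) :
    UsesBits (h.length * (2 * (2 * K * K))) fun R => taken z K R h := by
  induction h with
  | nil => intro R R' _; rfl
  | cons a h ih =>
    obtain ⟨e, b⟩ := a
    rw [List.length_cons, Nat.succ_mul]
    have h1 : UsesBits (h.length * (2 * (2 * K * K)) + 2 * (2 * K * K)) fun R =>
        accepts z K R (h.map Prod.fst) e := by
      simp only [accepts, List.length_map]
      exact (usesBits_twoCoins K _ _).comp_dropBits _
    exact (h1.map₂ (ih.mono (Nat.le_add_right _ _))) fun c s =>
      if b && c then matchUp e s else s

open scoped Classical in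
lemma history_insert {l : List (Sym2 (Fin n))} {e : Sym2 (Fin n)} (he : e ∉ l)
    (S : Finset (Sym2 (Fin n))) : history (insert e S) l = history S l := by
  simp only [history, List.map_inj_left, Finset.mem_insert]
  intro f hf
  have : f ≠ e := fun h => he (h ▸ hf)
  simp [this]

lemma history_map_fst (S : Finset (Sym2 (Fin n))) (l : List (Sym2 (Fin n))) :
    (history S l).map Prod.fst = l := by
  simp [history, Function.comp_def]

lemma bitE_ind_accepts_mul (l : List (Sym2 (Fin n))) (e : Sym2 (Fin n))
    {N : ℕ} (hN : (l.length + 1) * (2 * (2 * K * K)) ≤ N) (S : Finset (Sym2 (Fin n)))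
    (θ : (Fin n → Bool) → ℝ) :
    bitE N (fun R => θ (taken z K R (history S l)) * ind (accepts z K R l e)) =
      coinProb K (load z l e.inf) K * coinProb K (load z l e.sup) K *
        bitE N (fun R => θ (taken z K R (history S l))) := by
  have hu := (usesBits_taken (z := z) (K := K) (history S l)).map θ
  have hlen : (history S l).length = l.length := by simp [history]
  rw [hlen] at hu
  obtain ⟨k, rfl⟩ := Nat.exists_eq_add_of_le hN
  rw [Nat.succ_mul, add_assoc]
  simp only [accepts]
  rw [bitE_mul hu fun R => ind (twoCoins K _ _ R), bitE_of_usesBits _ hu,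
    bitE_of_usesBits _ ((usesBits_twoCoins K _ _).map ind), bitE_twoCoins, mul_comm]

open scoped Classical in
/-- The state of the arriving edge and its coins are independent of what happened before. -/
lemma sum_activeProb_bitE_accepts (x : Sym2 (Fin n) → ℝ) {E : Finset (Sym2 (Fin n))}
    {l : List (Sym2 (Fin n))} {e : Sym2 (Fin n)} (he : e ∉ l) (heE : e ∈ E) {N : ℕ}
    (hN : (l.length + 1) * (2 * (2 * K * K)) ≤ N) (θ : (Fin n → Bool) → ℝ) :
    ∑ S ∈ E.powerset, activeProb x E S * bitE N (fun R => ind (decide (e ∈ S)) *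
        (θ (taken z K R (history S l)) * ind (accepts z K R l e))) =
      coinRate x z K l e *
        ∑ S ∈ E.powerset, activeProb x E S * bitE N (fun R => θ (taken z K R (history S l))) := by
  simp only [bitE_const_mul, bitE_ind_accepts_mul l e hN]
  rw [sum_activeProb_mem x heE fun S => coinProb K (load z l e.inf) K *
    coinProb K (load z l e.sup) K * bitE N (fun R => θ (taken z K R (history S l)))]
  · rw [coinRate, Finset.mul_sum, Finset.mul_sum]
    refine Finset.sum_congr rfl fun S _ => by ring
  · intro S _
    rw [history_insert he]

open scoped Classical in
/-- Over the edge states and the random bits, the set of matched vertices follows the chain. -/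
lemma sum_activeProb_bitE_taken (x : Sym2 (Fin n) → ℝ) {E : Finset (Sym2 (Fin n))}
    {l : List (Sym2 (Fin n))} (hl : l.Nodup) (hlE : ∀ e ∈ l, e ∈ E) {N : ℕ}
    (hN : l.length * (2 * (2 * K * K)) ≤ N) (θ : (Fin n → Bool) → ℝ) :
    ∑ S ∈ E.powerset, activeProb x E S * bitE N (fun R => θ (taken z K R (history S l))) =
      chainE (coinRate x z K) l θ := by
  induction l generalizing θ with
  | nil =>
    simp only [history, List.map_nil, taken, bitE_const, chainE]
    rw [← Finset.sum_mul, sum_activeProb, one_mul]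
  | cons e l ih =>
    have he := (List.nodup_cons.1 hl).1
    have hN' : l.length * (2 * (2 * K * K)) ≤ N := le_trans (Nat.mul_le_mul_right _ (by simp)) hN
    have ih' := ih hl.of_cons (fun f hf => hlE f (List.mem_cons_of_mem _ hf)) hN'
    have h1 : ∀ S R, θ (taken z K R (history S (e :: l))) = θ (taken z K R (history S l)) +
        ind (decide (e ∈ S)) * ((θ (matchUp e (taken z K R (history S l))) -
          θ (taken z K R (history S l))) * ind (accepts z K R l e)) := by
      intro S R
      have h2 : taken z K R (history S (e :: l)) = if decide (e ∈ S) && accepts z K R l e then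
          matchUp e (taken z K R (history S l)) else taken z K R (history S l) := by
        conv_rhs => rw [← history_map_fst S l]
        simp only [history, List.map_cons, taken, List.map_map, Function.comp_def, List.map_id']
      rw [h2]
      by_cases h3 : e ∈ S <;> cases accepts z K R l e <;> simp [ind, h3]
    simp only [h1, bitE_add, mul_add]
    rw [Finset.sum_add_distrib, sum_activeProb_bitE_accepts x he (hlE e (by simp))
      (by simpa using hN) fun s => θ (matchUp e s) - θ s, ih',
      ih' fun s => θ (matchUp e s) - θ s, chainE_sub, chainE]
    ring

open scoped Classical in
lemma sum_activeProb_bitE_chooses (x : Sym2 (Fin n) → ℝ) {E : Finset (Sym2 (Fin n))}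
    {l : List (Sym2 (Fin n))} {e : Sym2 (Fin n)} (hl : (e :: l).Nodup)
    (hlE : ∀ f ∈ e :: l, f ∈ E) {N : ℕ} (hN : (l.length + 1) * (2 * (2 * K * K)) ≤ N) :
    ∑ S ∈ E.powerset, activeProb x E S *
        bitE N (fun R => ind (chooses z K R (history S (e :: l)))) =
      coinRate x z K l e *
        chainE (coinRate x z K) l (fun s => free e.inf s * free e.sup s) := by
  have he := (List.nodup_cons.1 hl).1
  have h1 : ∀ S R, ind (chooses z K R (history S (e :: l))) = ind (decide (e ∈ S)) *
      (free e.inf (taken z K R (history S l)) * free e.sup (taken z K R (history S l)) *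
        ind (accepts z K R l e)) := by
    intro S R
    have h2 : chooses z K R (history S (e :: l)) = (decide (e ∈ S) && accepts z K R l e &&
        (!taken z K R (history S l) e.inf && !taken z K R (history S l) e.sup)) := by
      conv_rhs => rw [← history_map_fst S l]
      simp only [history, List.map_cons, chooses, List.map_map, Function.comp_def, List.map_id']
    rw [h2, ind_and, ind_and, ind_and]
    have h3 : ∀ v (s : Fin n → Bool), ind (!s v) = free v s := fun v s => by
      cases h : s v <;> simp [ind, free, h]
    rw [h3, h3]
    ring
  simp only [h1]
  rw [sum_activeProb_bitE_accepts x he (hlE e (by simp)) hN fun s => free e.inf s * free e.sup s,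
    sum_activeProb_bitE_taken x hl.of_cons (fun f hf => hlE f (List.mem_cons_of_mem _ hf))
      (le_trans (Nat.mul_le_mul_right _ (by simp)) hN) fun s => free e.inf s * free e.sup s]

end Expectation

/-! ### Rounding errors -/

section Selectable

variable {n : ℕ}

local notation "α" => goldenAlpha

open scoped Classical in
lemma load_eq_sum {V M : Type*} [DecidableEq V] [AddCommMonoid M] (z : Sym2 V → M)
    {l : List (Sym2 V)} (hl : l.Nodup) (v : V) :
    load z l v = ∑ e ∈ l.toFinset with v ∈ e, z e := by
  induction l with
  | nil => simp [load]
  | cons e l ih =>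
    have he : e ∉ l.toFinset := by simpa using (List.nodup_cons.1 hl).1
    rw [load, ih hl.of_cons, Finset.sum_filter, Finset.sum_filter, List.toFinset_cons,
      Finset.sum_insert he, add_comm]

lemma Input.load_le_one (I : Input) {l : List (Sym2 (Fin I.n))} (hl : l.Nodup)
    (hlE : ∀ e ∈ l, e ∈ I.G.edgeSet) (v : Fin I.n) : load I.x l v ≤ 1 := by
  classical
  rw [load_eq_sum I.x hl]
  refine le_trans (Finset.sum_le_sum_of_subset_of_nonneg ?_ fun e _ _ => I.x_nonneg e)
    (I.sum_le_one v)
  intro e he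
  rw [Finset.mem_filter, List.mem_toFinset] at he
  rw [SimpleGraph.mem_incidenceFinset]
  exact ⟨hlE e he.1, he.2⟩

/-- The rounding error of a load, at most one unit for each of the at most `n` edges at `v`. -/
lemma load_approx {x : Sym2 (Fin n) → ℝ} {z : Sym2 (Fin n) → ℕ} {K : ℕ}
    (hz : ∀ e, (z e : ℝ) ≤ x e * 2 ^ K) (hz' : ∀ e, x e * 2 ^ K - 1 ≤ z e)
    {l : List (Sym2 (Fin n))} (hl : l.Nodup) (v : Fin n) :
    ((load z l v : ℕ) : ℝ) / 2 ^ K ≤ load x l v ∧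
      load x l v - n / 2 ^ K ≤ ((load z l v : ℕ) : ℝ) / 2 ^ K := by
  classical
  have h2 : (0 : ℝ) < 2 ^ K := by positivity
  rw [load_eq_sum x hl, load_eq_sum z hl]
  push_cast
  set A := {e ∈ l.toFinset | v ∈ e} with hA
  have hcard : (A.card : ℝ) ≤ n := by
    have : A ⊆ Finset.univ.image fun w : Fin n => s(v, w) := by
      intro e he
      obtain ⟨w, rfl⟩ := (Finset.mem_filter.1 he).2
      exact Finset.mem_image_of_mem _ (Finset.mem_univ w)
    have := (Finset.card_le_card this).trans Finset.card_image_le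
    simpa using this
  constructor
  · rw [div_le_iff₀ h2, Finset.sum_mul]
    exact Finset.sum_le_sum fun e _ => hz e
  · rw [sub_le_iff_le_add, ← add_div, le_div_iff₀ h2, Finset.sum_mul]
    have : ∑ e ∈ A, x e * 2 ^ K ≤ ∑ e ∈ A, ((z e : ℝ) + 1) :=
      Finset.sum_le_sum fun e _ => by linarith [hz' e]
    rw [Finset.sum_add_distrib] at this
    simp only [Finset.sum_const, nsmul_eq_mul, mul_one] at this
    linarith

/-- The errors of the two coins add up; each is at most the rounding error `n / 2 ^ K` of the load
plus the truncation errors of the walk and of the number of rounds. -/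
lemma nearIdeal_coinRate {x : Sym2 (Fin n) → ℝ} {z : Sym2 (Fin n) → ℕ} {K : ℕ}
    (hx : ∀ e, 0 ≤ x e) (hz : ∀ e, (z e : ℝ) ≤ x e * 2 ^ K)
    (hz' : ∀ e, x e * 2 ^ K - 1 ≤ z e) :
    NearIdeal x (2 * (n / 2 ^ K + 3 * 0.9606 ^ K)) (coinRate x z K) := by
  intro l u w hl
  have hl' := hl.of_cons hx
  have hm1 := hl'.2.2
  have hap := load_approx hz hz' hl'.1
  have hα := goldenAlpha_gt
  have hα' := goldenAlpha_lt
  have hpow : α ^ K ≤ 0.9606 ^ K := pow_le_pow_left₀ (by linarith) (by linarith) K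
  have hup := fun v => coinProb_le_accept (hm1 v) (hap v).1 K
  have hlo := fun v => accept_sub_coinProb_le (hm1 v) (hap v).1 (hap v).2 K
  have hsymm : coinRate x z K l s(u, w) = x s(u, w) *
      (coinProb K (load z l u) K * coinProb K (load z l w) K) := by
    rcases le_total u w with h | h
    · simp [coinRate, Sym2.inf, Sym2.sup, h]
    · simp [coinRate, Sym2.inf, Sym2.sup, h, mul_comm]
  have hxe := hx s(u, w)
  have c0 := fun v => coinProb_nonneg K (load z l v) K
  have a0 := fun v => accept_nonneg (hm1 v)
  have a1 := fun v => accept_le_one (hm1 v)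
  rw [hsymm]
  refine ⟨mul_le_mul_of_nonneg_left (mul_le_mul (hup u) (hup w) (c0 w) (a0 u)) hxe,
    mul_le_mul_of_nonneg_left ?_ hxe⟩
  have hu := hlo u
  have hw := hlo w
  have t1 := mul_le_of_le_one_right (sub_nonneg.2 (hup u)) (a1 w)
  have t2 := mul_le_of_le_one_left (sub_nonneg.2 (hup w))
    (coinProb_le_one K (load z l u) K)
  linarith

/-- The truncation error of the walk in terms of the precision: `0.9606 ^ 20 ≤ 1 / 2`. -/
lemma pow_le_rpow {ε : ℝ} {K : ℕ} (hε : 0 < ε) (hK : 1 ≤ ε * 2 ^ K) :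
    (0.9606 : ℝ) ^ K ≤ ε ^ (1 / 20 : ℝ) := by
  have h1 : (ε ^ (1 / 20 : ℝ)) ^ 20 = ε := by
    rw [← Real.rpow_natCast, ← Real.rpow_mul hε.le]; norm_num
  refine le_of_pow_le_pow_left₀ (n := 20) (by norm_num) (by positivity) ?_
  rw [h1, ← pow_mul, mul_comm K, pow_mul]
  have h2 : ((0.9606 : ℝ) ^ 20) ^ K ≤ (1 / 2) ^ K :=
    pow_le_pow_left₀ (by positivity) (by norm_num) K
  refine h2.trans ?_
  rw [one_div, inv_pow, inv_le_iff_one_le_mul₀ (by positivity)]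
  exact hK

lemma Input.x_le_maxValue (I : Input) (e : Sym2 (Fin I.n)) : I.x e ≤ I.maxValue := by
  have hb : BddAbove (Set.range fun e : I.G.edgeSet => I.x e) := (Set.finite_range _).bddAbove
  by_cases he : e ∈ I.G.edgeSet
  · exact le_ciSup hb ⟨e, he⟩
  · rw [I.x_off e he]
    exact Real.iSup_nonneg fun e => I.x_nonneg e

/-- With enough precision `K`, whatever the arrival order, the scheme selects every edge with
probability almost `α` times its value. -/
lemma Input.le_sum_activeProb_chooses (I : Input) {E : Finset (Sym2 (Fin I.n))}
    (hE : ∀ e, e ∈ E ↔ e ∈ I.G.edgeSet) {K N : ℕ} {z : Sym2 (Fin I.n) → ℕ}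
    (hz : ∀ e, (z e : ℝ) ≤ I.x e * 2 ^ K) (hz' : ∀ e, I.x e * 2 ^ K - 1 ≤ z e)
    (hε : 0 < I.maxValue) (hε1 : I.maxValue ≤ 1) (hK : (I.n : ℝ) ≤ I.maxValue * 2 ^ K)
    (hK' : 1 ≤ I.maxValue * 2 ^ K) {l : List (Sym2 (Fin I.n))} {e : Sym2 (Fin I.n)}
    (hl : (e :: l).Nodup) (hlE : ∀ f ∈ e :: l, f ∈ I.G.edgeSet)
    (hN : (l.length + 1) * (2 * (2 * K * K)) ≤ N) :
    (α - 1200 * I.maxValue ^ (1 / 20 : ℝ)) * I.x e ≤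
      ∑ S ∈ E.powerset, activeProb I.x E S *
        bitE N (fun R => ind (chooses z K R (history S (e :: l)))) := by
  have hx1 : ∀ e, I.x e ≤ 1 := fun e => (I.x_le_maxValue e).trans hε1
  have hr0 : ∀ l e, 0 ≤ coinRate I.x z K l e := fun l e =>
    mul_nonneg (I.x_nonneg e) (mul_nonneg (coinProb_nonneg _ _ _) (coinProb_nonneg _ _ _))
  have hr1 : ∀ l e, coinRate I.x z K l e ≤ 1 := fun l e =>
    mul_le_one₀ (hx1 e) (mul_nonneg (coinProb_nonneg _ _ _) (coinProb_nonneg _ _ _))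
      (mul_le_one₀ (coinProb_le_one _ _ _) (coinProb_nonneg _ _ _) (coinProb_le_one _ _ _))
  have had : Admissible I.x (s(e.inf, e.sup) :: l) := by
    rw [mk_inf_sup]
    exact ⟨hl, fun f hf => I.G.not_isDiag_of_mem_edgeSet (hlE f hf), I.load_le_one hl hlE⟩
  have h := rate_mul_chainE_free_ge hr0 hr1 I.x_nonneg I.x_le_maxValue hε.le (by positivity)
    (nearIdeal_coinRate I.x_nonneg hz hz') had
  rw [mk_inf_sup] at h
  rw [sum_activeProb_bitE_chooses I.x hl (fun f hf => (hE f).2 (hlE f hf)) hN]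
  refine le_trans ?_ h
  rw [mul_comm]
  refine mul_le_mul_of_nonneg_left ?_ (I.x_nonneg e)
  -- the error is `1100 * ε + 7 * δ` with `δ ≤ 2 * ε + 6 * ε ^ (1 / 20)`
  have hp := pow_le_rpow hε hK'
  have he1 : I.maxValue ≤ I.maxValue ^ (1 / 20 : ℝ) := by
    conv_lhs => rw [← Real.rpow_one I.maxValue]
    exact Real.rpow_le_rpow_of_exponent_ge hε hε1 (by norm_num)
  have hn : (I.n : ℝ) / 2 ^ K ≤ I.maxValue := by
    rwa [div_le_iff₀ (by positivity)]
  linarith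

end Selectable

/-! ### Straight-line code and loops on the machine -/

section Machine

/-- Started with memory `σ`, the program `p` halts within `T` steps with memory `τ`. -/
def Runs (p : Program) (σ : Memory) (T : ℕ) (τ : Memory) : Prop := ∃ t ≤ T, Exec p σ t τ

lemma Runs.mono {p : Program} {σ τ : Memory} {T T' : ℕ} (h : Runs p σ T τ) (hT : T ≤ T') :
    Runs p σ T' τ := let ⟨t, ht, he⟩ := h; ⟨t, ht.trans hT, he⟩

lemma Runs.skip (σ : Memory) : Runs .skip σ 1 σ := ⟨1, le_rfl, .skip σ⟩

lemma Runs.seq {p₁ p₂ : Program} {σ τ ρ : Memory} {T₁ T₂ : ℕ} (h₁ : Runs p₁ σ T₁ τ)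
    (h₂ : Runs p₂ τ T₂ ρ) : Runs (.seq p₁ p₂) σ (T₁ + T₂) ρ :=
  let ⟨t₁, ht₁, e₁⟩ := h₁
  let ⟨t₂, ht₂, e₂⟩ := h₂
  ⟨t₁ + t₂, Nat.add_le_add ht₁ ht₂, .seq e₁ e₂⟩

lemma Runs.ite {b : Expr} {p₁ p₂ : Program} {σ τ : Memory} {T : ℕ}
    (h₁ : b.eval σ ≠ 0 → Runs p₁ σ T τ) (h₂ : b.eval σ = 0 → Runs p₂ σ T τ) :
    Runs (.ite b p₁ p₂) σ (b.cost + 1 + T) τ := by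
  by_cases hb : b.eval σ = 0
  · obtain ⟨t, ht, e⟩ := h₂ hb
    exact ⟨_, Nat.add_le_add_left ht _, .ite_false hb e⟩
  · obtain ⟨t, ht, e⟩ := h₁ hb
    exact ⟨_, Nat.add_le_add_left ht _, .ite_true hb e⟩

lemma Runs.loop_done {b : Expr} {p : Program} {σ : Memory} (hb : b.eval σ = 0) :
    Runs (.loop b p) σ (b.cost + 1) σ := ⟨_, le_rfl, .loop_done hb⟩

lemma Runs.loop_step {b : Expr} {p : Program} {σ τ ρ : Memory} {T₁ T₂ : ℕ} (hb : b.eval σ ≠ 0)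
    (h₁ : Runs p σ T₁ τ) (h₂ : Runs (.loop b p) τ T₂ ρ) :
    Runs (.loop b p) σ (b.cost + 1 + T₁ + T₂) ρ :=
  let ⟨_, ht₁, e₁⟩ := h₁
  let ⟨_, ht₂, e₂⟩ := h₂
  ⟨_, Nat.add_le_add (Nat.add_le_add_left ht₁ _) ht₂, .loop_step hb e₁ e₂⟩

/-- The machine is deterministic. -/
lemma Exec.unique {p : Program} {σ τ τ' : Memory} {t t' : ℕ} (h : Exec p σ t τ)
    (h' : Exec p σ t' τ') : τ = τ' := by
  induction h generalizing t' τ' with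
  | skip => cases h'; rfl
  | set => cases h'; rfl
  | seq _ _ ih₁ ih₂ =>
    cases h' with
    | seq e₁ e₂ => obtain rfl := ih₁ e₁; exact ih₂ e₂
  | ite_true hb _ ih =>
    cases h' with
    | ite_true _ e => exact ih e
    | ite_false hb' _ => exact absurd hb' hb
  | ite_false hb _ ih =>
    cases h' with
    | ite_true hb' _ => exact absurd hb hb'
    | ite_false _ e => exact ih e
  | loop_done hb =>
    cases h' with
    | loop_done => rfl
    | loop_step hb' _ _ => exact absurd hb hb'
  | loop_step hb _ _ ih₁ ih₂ =>
    cases h' with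
    | loop_done hb' => exact absurd hb' hb
    | loop_step _ e₁ e₂ => obtain rfl := ih₁ e₁; exact ih₂ e₂

/-- The values of the variables of the scheme's program. -/
structure Regs where
  /-- The last decision, in the output cell. -/
  out : ℕ
  /-- The scaled total value of the arrived edges at each vertex. -/
  load : ℕ → ℕ
  /-- Which vertices are matched. -/
  taken : ℕ → ℕ
  /-- The precision. -/
  prec : ℕ
  /-- The index of a vertex, and later the number of processed arrivals. -/
  i : ℕ
  /-- The index of a vertex, and later the number of arrivals that are still to be processed. -/
  j : ℕ
  /-- A power of two, and later a remainder. -/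
  rest : ℕ
  /-- A quotient. -/
  quot : ℕ
  /-- The counter of the innermost loops. -/
  cnt : ℕ
  /-- The number of random bits used. -/
  ptr : ℕ
  /-- The position of the walk. -/
  pos : ℕ
  /-- The number read from random bits. -/
  num : ℕ
  /-- The state of a geometric coin: `0` undecided, `1` rejected, `2` accepted. -/
  st : ℕ
  /-- Whether the arrival is active and accepted so far. -/
  acc : ℕ
  /-- The number of remaining rounds of a geometric coin. -/
  rnd : ℕ

/-- The memory with the variables `s`, in the arrays from `7` on, and the input `B`. -/
def Regs.mem (B : Memory) (s : Regs) : Memory := fun a i j =>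
  match a with
  | 7 => if i = 0 ∧ j = 0 then s.out else 0
  | 8 => if j = 0 then s.load i else 0
  | 9 => if j = 0 then s.taken i else 0
  | 10 => if i = 0 ∧ j = 0 then s.prec else 0
  | 11 => if i = 0 ∧ j = 0 then s.i else 0
  | 12 => if i = 0 ∧ j = 0 then s.j else 0
  | 13 => if i = 0 ∧ j = 0 then s.rest else 0
  | 14 => if i = 0 ∧ j = 0 then s.quot else 0
  | 15 => if i = 0 ∧ j = 0 then s.cnt else 0
  | 16 => if i = 0 ∧ j = 0 then s.ptr else 0
  | 17 => if i = 0 ∧ j = 0 then s.pos else 0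
  | 18 => if i = 0 ∧ j = 0 then s.num else 0
  | 19 => if i = 0 ∧ j = 0 then s.st else 0
  | 20 => if i = 0 ∧ j = 0 then s.acc else 0
  | 21 => if i = 0 ∧ j = 0 then s.rnd else 0
  | a => B a i j

/-- The variable stored in the cell `(a, 0, 0)`. -/
abbrev Expr.var (a : ℕ) : Expr := .get a (.lit 0) (.lit 0)

/-- The assignment of `e` to the variable stored in the cell `(a, 0, 0)`. -/
abbrev Program.assign (a : ℕ) (e : Expr) : Program := .set a (.lit 0) (.lit 0) e

variable {B : Memory} {s : Regs}

lemma Runs.set_of_eq {a : ℕ} {i j e : Expr} {σ τ : Memory} {T : ℕ}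
    (hτ : σ.write a (i.eval σ) (j.eval σ) (e.eval σ) = τ)
    (hT : i.cost + j.cost + e.cost + 1 ≤ T) : Runs (.set a i j e) σ T τ :=
  ⟨_, hT, hτ ▸ .set a i j e σ⟩

lemma write_load (v k : ℕ) :
    (s.mem B).write 8 v 0 k = Regs.mem B { s with load := Function.update s.load v k } := by
  funext a i j
  by_cases h : a = 8 ∧ i = v ∧ j = 0
  · obtain ⟨rfl, rfl, rfl⟩ := h; simp [Memory.write, Regs.mem]
  · rw [Memory.write, if_neg h]
    unfold Regs.mem
    split <;> grind

lemma write_scalar (k : ℕ) :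
    (s.mem B).write 7 0 0 k = Regs.mem B { s with out := k } ∧
    (s.mem B).write 10 0 0 k = Regs.mem B { s with prec := k } ∧
    (s.mem B).write 11 0 0 k = Regs.mem B { s with i := k } ∧
    (s.mem B).write 12 0 0 k = Regs.mem B { s with j := k } ∧
    (s.mem B).write 13 0 0 k = Regs.mem B { s with rest := k } ∧
    (s.mem B).write 14 0 0 k = Regs.mem B { s with quot := k } ∧
    (s.mem B).write 15 0 0 k = Regs.mem B { s with cnt := k } ∧
    (s.mem B).write 16 0 0 k = Regs.mem B { s with ptr := k } ∧
    (s.mem B).write 17 0 0 k = Regs.mem B { s with pos := k } ∧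
    (s.mem B).write 18 0 0 k = Regs.mem B { s with num := k } ∧
    (s.mem B).write 19 0 0 k = Regs.mem B { s with st := k } ∧
    (s.mem B).write 20 0 0 k = Regs.mem B { s with acc := k } ∧
    (s.mem B).write 21 0 0 k = Regs.mem B { s with rnd := k } := by
  refine ⟨?_, ?_, ?_, ?_, ?_, ?_, ?_, ?_, ?_, ?_, ?_, ?_, ?_⟩ <;>
  · funext a i j
    unfold Memory.write Regs.mem
    by_cases h : i = 0 ∧ j = 0
    · obtain ⟨rfl, rfl⟩ := h
      split <;> grind
    · split <;> grind

lemma write_taken (v k : ℕ) :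
    (s.mem B).write 9 v 0 k = Regs.mem B { s with taken := Function.update s.taken v k } := by
  funext a i j
  by_cases h : a = 9 ∧ i = v ∧ j = 0
  · obtain ⟨rfl, rfl, rfl⟩ := h; simp [Memory.write, Regs.mem]
  · rw [Memory.write, if_neg h]
    unfold Regs.mem
    split <;> grind

lemma mem_scalar :
    s.mem B 7 0 0 = s.out ∧
    s.mem B 10 0 0 = s.prec ∧
    s.mem B 11 0 0 = s.i ∧
    s.mem B 12 0 0 = s.j ∧
    s.mem B 13 0 0 = s.rest ∧
    s.mem B 14 0 0 = s.quot ∧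
    s.mem B 15 0 0 = s.cnt ∧
    s.mem B 16 0 0 = s.ptr ∧
    s.mem B 17 0 0 = s.pos ∧
    s.mem B 18 0 0 = s.num ∧
    s.mem B 19 0 0 = s.st ∧
    s.mem B 20 0 0 = s.acc ∧
    s.mem B 21 0 0 = s.rnd :=
  ⟨rfl, rfl, rfl, rfl, rfl, rfl, rfl, rfl, rfl, rfl, rfl, rfl, rfl⟩

lemma mem_array (i j : ℕ) :
    s.mem B 0 i j = B 0 i j ∧ s.mem B 1 i j = B 1 i j ∧ s.mem B 3 i j = B 3 i j ∧
    s.mem B 4 i j = B 4 i j ∧ s.mem B 5 i j = B 5 i j ∧ s.mem B 6 i j = B 6 i j :=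
  ⟨rfl, rfl, rfl, rfl, rfl, rfl⟩

lemma mem_vertex (v : ℕ) : s.mem B 8 v 0 = s.load v ∧ s.mem B 9 v 0 = s.taken v := ⟨rfl, rfl⟩

lemma Runs.cast {p : Program} {σ τ τ' : Memory} {T T' : ℕ} (h : Runs p σ T τ) (hτ : τ = τ')
    (hT : T ≤ T') : Runs p σ T' τ' := hτ ▸ h.mono hT

lemma Runs.assign {a : ℕ} (e : Expr) {τ : Memory}
    (hτ : (s.mem B).write a 0 0 (e.eval (s.mem B)) = τ) :
    Runs (.assign a e) (s.mem B) (e.cost + 3) τ :=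
  Runs.set_of_eq hτ (by simp only [Expr.cost]; omega)

lemma runs_out (e : Expr) : Runs (.assign 7 e) (s.mem B) (e.cost + 3)
    (Regs.mem B { s with out := e.eval (s.mem B) }) := .assign e (write_scalar _).1

lemma runs_prec (e : Expr) : Runs (.assign 10 e) (s.mem B) (e.cost + 3)
    (Regs.mem B { s with prec := e.eval (s.mem B) }) := .assign e (write_scalar _).2.1

lemma runs_i (e : Expr) : Runs (.assign 11 e) (s.mem B) (e.cost + 3)
    (Regs.mem B { s with i := e.eval (s.mem B) }) := .assign e (write_scalar _).2.2.1

lemma runs_j (e : Expr) : Runs (.assign 12 e) (s.mem B) (e.cost + 3)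
    (Regs.mem B { s with j := e.eval (s.mem B) }) := .assign e (write_scalar _).2.2.2.1

lemma runs_rest (e : Expr) : Runs (.assign 13 e) (s.mem B) (e.cost + 3)
    (Regs.mem B { s with rest := e.eval (s.mem B) }) := .assign e (write_scalar _).2.2.2.2.1

lemma runs_quot (e : Expr) : Runs (.assign 14 e) (s.mem B) (e.cost + 3)
    (Regs.mem B { s with quot := e.eval (s.mem B) }) := .assign e (write_scalar _).2.2.2.2.2.1

lemma runs_cnt (e : Expr) : Runs (.assign 15 e) (s.mem B) (e.cost + 3)
    (Regs.mem B { s with cnt := e.eval (s.mem B) }) := .assign e (write_scalar _).2.2.2.2.2.2.1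

lemma runs_ptr (e : Expr) : Runs (.assign 16 e) (s.mem B) (e.cost + 3)
    (Regs.mem B { s with ptr := e.eval (s.mem B) }) := .assign e (write_scalar _).2.2.2.2.2.2.2.1

lemma runs_pos (e : Expr) : Runs (.assign 17 e) (s.mem B) (e.cost + 3)
    (Regs.mem B { s with pos := e.eval (s.mem B) }) := .assign e (write_scalar _).2.2.2.2.2.2.2.2.1

lemma runs_num (e : Expr) : Runs (.assign 18 e) (s.mem B) (e.cost + 3)
    (Regs.mem B { s with num := e.eval (s.mem B) }) :=
  .assign e (write_scalar _).2.2.2.2.2.2.2.2.2.1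

lemma runs_st (e : Expr) : Runs (.assign 19 e) (s.mem B) (e.cost + 3)
    (Regs.mem B { s with st := e.eval (s.mem B) }) :=
  .assign e (write_scalar _).2.2.2.2.2.2.2.2.2.2.1

lemma runs_acc (e : Expr) : Runs (.assign 20 e) (s.mem B) (e.cost + 3)
    (Regs.mem B { s with acc := e.eval (s.mem B) }) :=
  .assign e (write_scalar _).2.2.2.2.2.2.2.2.2.2.2.1

lemma runs_rnd (e : Expr) : Runs (.assign 21 e) (s.mem B) (e.cost + 3)
    (Regs.mem B { s with rnd := e.eval (s.mem B) }) :=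
  .assign e (write_scalar _).2.2.2.2.2.2.2.2.2.2.2.2

end Machine

/-! ### The inner loops of the program -/

section Fragments

/-- The current random bit. -/
abbrev bitExpr : Expr := .get 5 (.var 16) (.lit 0)

/-- The endpoint number `c` of the current arrival. -/
abbrev endExpr (c : ℕ) : Expr := .get 6 (.var 11) (.lit c)

/-- The denominator of the value of the current arrival. -/
abbrev denExpr : Expr := .get 4 (endExpr 0) (endExpr 1)

/-- Increase a variable by `1`. -/
abbrev Program.incr (a : ℕ) : Program := .assign a (.add (.var a) (.lit 1))

/-- Decrease a variable by `1`, but not below `0`. -/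
abbrev Program.decr (a : ℕ) : Program := .assign a (.sub (.var a) (.lit 1))

/-- `cnt` steps of the walk. -/
def walkLoop : Program :=
  .loop (.var 15) (.seq
    (.ite (.var 17)
      (.assign 17 (.add (.sub (.var 17) (.lit 1)) (.add bitExpr (.add bitExpr bitExpr)))) .skip)
    (.seq (.incr 16) (.decr 15)))

/-- Read a number from `cnt` bits. -/
def readLoop : Program :=
  .loop (.var 15) (.seq (.assign 18 (.add (.add (.var 18) (.var 18)) bitExpr))
    (.seq (.incr 16) (.decr 15)))

/-- `cnt` steps of long division by the denominator of the value of the current arrival. -/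
def divLoop : Program :=
  .loop (.var 15) (.seq (.assign 13 (.add (.var 13) (.var 13)))
    (.seq (.assign 14 (.add (.var 14) (.var 14)))
    (.seq (.ite (.sub (.add (.var 13) (.lit 1)) denExpr)
        (.seq (.assign 13 (.sub (.var 13) denExpr)) (.incr 14)) .skip)
      (.decr 15))))

/-- One round of the geometric coin of the endpoint number `c`. -/
def coinRound (c : ℕ) : Program :=
  .seq (.decr 21) (.seq (.assign 17 (.lit 1)) (.seq (.assign 15 (.var 10)) (.seq walkLoop
    (.seq (.assign 18 (.lit 0)) (.seq (.assign 15 (.var 10)) (.seq readLoop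
      (.ite (.var 19) .skip (.ite (.var 17)
        (.ite (.sub (.get 8 (endExpr c) (.lit 0)) (.var 18)) .skip (.assign 19 (.lit 1)))
        (.assign 19 (.lit 2))))))))))

/-- The geometric coin of the endpoint number `c`: unless it accepts, `acc` becomes `0`. -/
def coinProgram (c : ℕ) : Program :=
  .seq (.assign 19 (.lit 0)) (.seq (.assign 21 (.var 10)) (.seq (.loop (.var 21) (coinRound c))
    (.ite (.sub (.var 19) (.lit 1)) .skip (.assign 20 (.lit 0)))))

variable {B : Memory} {R : ℕ → Bool}

lemma dropBits_apply_zero (m : ℕ) (R : ℕ → Bool) : dropBits m R 0 = R m := by simp [dropBits]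

lemma dropBits_one_dropBits (m : ℕ) (R : ℕ → Bool) :
    dropBits 1 (dropBits m R) = dropBits (m + 1) R := by rw [dropBits_dropBits, add_comm]

lemma runs_walkLoop (hB : ∀ i, B 5 i 0 = (R i).toNat) (k : ℕ) (s : Regs) (hs : s.cnt = k) :
    Runs walkLoop (s.mem B) (60 * k + 4)
      (Regs.mem B { s with
        cnt := 0, ptr := s.ptr + k, pos := walk k s.pos (dropBits s.ptr R) }) := by
  induction k generalizing s with
  | zero =>
    refine (Runs.loop_done (by simpa [Expr.eval, mem_scalar] using hs)).cast ?_
      (by simp [Expr.cost])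
    cases s; cases hs; rfl
  | succ k ih =>
    have h1 : Runs (.ite (.var 17)
        (.assign 17 (.add (.sub (.var 17) (.lit 1)) (.add bitExpr (.add bitExpr bitExpr)))) .skip)
        (s.mem B) 40 (Regs.mem B { s with
          pos := if s.pos = 0 then 0 else s.pos - 1 + 3 * (R s.ptr).toNat }) := by
      refine (Runs.ite (T := 30) (fun h => ?_) fun h => ?_).mono (by simp [Expr.cost])
      · refine (runs_pos _).cast ?_ (by simp [Expr.cost])
        simp only [Expr.eval, mem_scalar] at h
        simp only [Expr.eval, mem_scalar, mem_array, hB, if_neg h]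
        congr 2; ring
      · refine (Runs.skip _).cast ?_ (by simp)
        simp only [Expr.eval, mem_scalar] at h
        simp [← h]
    have h2 := h1.seq ((runs_ptr (.add (.var 16) (.lit 1))).seq
      (runs_cnt (.sub (.var 15) (.lit 1))))
    simp only [Expr.eval, mem_scalar] at h2
    refine (Runs.loop_step (by simp [Expr.eval, mem_scalar, hs]) h2
      (ih _ (by simp [hs]))).cast ?_ (by simp [Expr.cost]; omega)
    simp only [walk, dropBits_apply_zero, dropBits_one_dropBits]
    congr 2; ring

lemma runs_readLoop (hB : ∀ i, B 5 i 0 = (R i).toNat) (k : ℕ) (s : Regs) (hs : s.cnt = k) :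
    Runs readLoop (s.mem B) (60 * k + 4)
      (Regs.mem B { s with
        cnt := 0, ptr := s.ptr + k, num := readNum k s.num (dropBits s.ptr R) }) := by
  induction k generalizing s with
  | zero =>
    refine (Runs.loop_done (by simpa [Expr.eval, mem_scalar] using hs)).cast ?_
      (by simp [Expr.cost])
    cases s; cases hs; rfl
  | succ k ih =>
    have h2 := (runs_num (B := B) (s := s) (.add (.add (.var 18) (.var 18)) bitExpr)).seq
      ((runs_ptr (.add (.var 16) (.lit 1))).seq (runs_cnt (.sub (.var 15) (.lit 1))))
    simp only [Expr.eval, mem_scalar, mem_array] at h2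
    refine (Runs.loop_step (by simp [Expr.eval, mem_scalar, hs]) h2
      (ih _ (by simp [hs]))).cast ?_ (by simp [Expr.cost]; omega)
    simp only [readNum, dropBits_apply_zero, dropBits_one_dropBits, hB]
    congr 2
    · ring
    · congr 1; ring

/-- `k` steps of the long division by `d`, on a pair of a remainder and a quotient. -/
def longDiv (d : ℕ) : ℕ → ℕ × ℕ → ℕ × ℕ
  | 0, rc => rc
  | k + 1, (r, c) => longDiv d k (if d ≤ 2 * r then (2 * r - d, 2 * c + 1) else (2 * r, 2 * c))

lemma longDiv_spec (d k r c : ℕ) (hr : r ≤ d) :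
    (longDiv d k (r, c)).2 * d + (longDiv d k (r, c)).1 = (c * d + r) * 2 ^ k ∧
      (longDiv d k (r, c)).1 ≤ d := by
  induction k generalizing r c with
  | zero => simp [longDiv, hr]
  | succ k ih =>
    rw [longDiv]
    split_ifs with h
    · obtain ⟨h1, h2⟩ := ih (2 * r - d) (2 * c + 1) (by omega)
      refine ⟨?_, h2⟩
      have : (2 * c + 1) * d + (2 * r - d) = 2 * (c * d + r) := by
        have : (2 * c + 1) * d = 2 * (c * d) + d := by ring
        omega
      rw [h1, this]; ring
    · obtain ⟨h1, h2⟩ := ih (2 * r) (2 * c) (by omega)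
      refine ⟨?_, h2⟩
      rw [h1]; ring

lemma runs_divLoop (k : ℕ) (s : Regs) (hs : s.cnt = k) :
    Runs divLoop (s.mem B) (120 * k + 4)
      (Regs.mem B { s with
        cnt := 0
        rest := (longDiv (B 4 (B 6 s.i 0) (B 6 s.i 1)) k (s.rest, s.quot)).1
        quot := (longDiv (B 4 (B 6 s.i 0) (B 6 s.i 1)) k (s.rest, s.quot)).2 }) := by
  induction k generalizing s with
  | zero =>
    refine (Runs.loop_done (by simpa [Expr.eval, mem_scalar] using hs)).cast ?_
      (by simp [Expr.cost])
    cases s; cases hs; rfl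
  | succ k ih =>
    have h1 : ∀ s : Regs, Runs (.ite (.sub (.add (.var 13) (.lit 1)) denExpr)
        (.seq (.assign 13 (.sub (.var 13) denExpr)) (.incr 14)) .skip) (s.mem B) 50
          (Regs.mem B { s with
            rest := if B 4 (B 6 s.i 0) (B 6 s.i 1) ≤ s.rest
              then s.rest - B 4 (B 6 s.i 0) (B 6 s.i 1) else s.rest
            quot := if B 4 (B 6 s.i 0) (B 6 s.i 1) ≤ s.rest then s.quot + 1 else s.quot }) := by
      intro s
      refine (Runs.ite (T := 30) (fun h => ?_) fun h => ?_).mono (by simp [Expr.cost])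
      · refine ((runs_rest _).seq (runs_quot _)).cast ?_ (by simp [Expr.cost])
        simp only [Expr.eval, mem_scalar, mem_array] at h
        have h' : B 4 (B 6 s.i 0) (B 6 s.i 1) ≤ s.rest := by omega
        simp only [Expr.eval, mem_scalar, mem_array, if_pos h']
      · refine (Runs.skip _).cast ?_ (by simp)
        simp only [Expr.eval, mem_scalar, mem_array] at h
        have h' : ¬ B 4 (B 6 s.i 0) (B 6 s.i 1) ≤ s.rest := by omega
        simp only [if_neg h']
    have h2 := (runs_rest (B := B) (s := s) (.add (.var 13) (.var 13))).seq
      ((runs_quot (.add (.var 14) (.var 14))).seq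
        ((h1 _).seq (runs_cnt (.sub (.var 15) (.lit 1)))))
    simp only [Expr.eval, mem_scalar] at h2
    refine (Runs.loop_step (by simp [Expr.eval, mem_scalar, hs]) h2
      (ih _ (by simp [hs]))).cast ?_ (by simp [Expr.cost]; omega)
    simp only [longDiv, two_mul]
    split_ifs <;> rfl

end Fragments

/-! ### The program of a geometric coin -/

section CoinProgram

variable {B : Memory} {R : ℕ → Bool}

/-- The state of a geometric coin after a round with the bits `R`. -/
def roundState (K Z st : ℕ) (R : ℕ → Bool) : ℕ :=
  if st ≠ 0 then st else
    if walk K 1 R = 0 then 2 else if readNum K 0 (dropBits K R) < Z then 0 else 1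

/-- The state of a geometric coin after `k` rounds. -/
def coinState (K Z : ℕ) : ℕ → ℕ → (ℕ → Bool) → ℕ
  | 0, st, _ => st
  | k + 1, st, R => coinState K Z k (roundState K Z st R) (dropBits (2 * K) R)

lemma coinState_of_ne_zero (K Z k : ℕ) {st : ℕ} (h : st ≠ 0) (R : ℕ → Bool) :
    coinState K Z k st R = st := by
  induction k generalizing R with
  | zero => rfl
  | succ k ih => rw [coinState, roundState, if_pos h, ih]

lemma one_lt_coinState (K Z k : ℕ) (R : ℕ → Bool) :
    1 < coinState K Z k 0 R ↔ coin K Z k R = true := by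
  induction k generalizing R with
  | zero => simp [coinState, coin]
  | succ k ih =>
    rw [coinState, coin, roundState, if_neg (by simp)]
    by_cases h1 : walk K 1 R = 0
    · simp [h1, coinState_of_ne_zero]
    · by_cases h2 : readNum K 0 (dropBits K R) < Z
      · simp [h1, h2, ih]
      · simp [h1, h2, coinState_of_ne_zero K Z k one_ne_zero]

lemma runs_coinRound (hB : ∀ i, B 5 i 0 = (R i).toNat) (c : ℕ) (s : Regs) :
    Runs (coinRound c) (s.mem B) (120 * s.prec + 110)
      (Regs.mem B { s with
        rnd := s.rnd - 1
        pos := walk s.prec 1 (dropBits s.ptr R)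
        cnt := 0
        num := readNum s.prec 0 (dropBits s.prec (dropBits s.ptr R))
        ptr := s.ptr + 2 * s.prec
        st := roundState s.prec (s.load (B 6 s.i c)) s.st (dropBits s.ptr R) }) := by
  have h1 : ∀ s : Regs, Runs (.ite (.var 19) .skip (.ite (.var 17)
      (.ite (.sub (.get 8 (endExpr c) (.lit 0)) (.var 18)) .skip (.assign 19 (.lit 1)))
      (.assign 19 (.lit 2)))) (s.mem B) 40 (Regs.mem B { s with
        st := if s.st ≠ 0 then s.st else if s.pos = 0 then 2 else
          if s.num < s.load (B 6 s.i c) then 0 else 1 }) := by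
    intro s
    refine (Runs.ite (T := 35) (fun h => ?_) fun h => ?_).mono (by simp [Expr.cost])
    · simp only [Expr.eval, mem_scalar] at h
      refine (Runs.skip _).cast ?_ (by simp)
      rw [if_pos h]
    · simp only [Expr.eval, mem_scalar] at h
      refine (Runs.ite (T := 25) (fun h' => ?_) fun h' => ?_).mono (by simp [Expr.cost])
      · simp only [Expr.eval, mem_scalar] at h'
        refine (Runs.ite (T := 10) (fun h2 => ?_) fun h2 => ?_).mono (by simp [Expr.cost])
        · simp only [Expr.eval, mem_scalar, mem_array, mem_vertex] at h2
          refine (Runs.skip _).cast ?_ (by simp)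
          rw [if_neg (by simpa using h), if_neg h', if_pos (by omega), ← h]
        · simp only [Expr.eval, mem_scalar, mem_array, mem_vertex] at h2
          refine (runs_st _).cast ?_ (by simp [Expr.cost])
          rw [if_neg (by simpa using h), if_neg h', if_neg (by omega)]
          rfl
      · simp only [Expr.eval, mem_scalar] at h'
        refine (runs_st _).cast ?_ (by simp [Expr.cost])
        rw [if_neg (by simpa using h), if_pos h']
        rfl
  have h2 := (runs_rnd (B := B) (s := s) (.sub (.var 21) (.lit 1))).seq
    ((runs_pos (.lit 1)).seq ((runs_cnt (.var 10)).seq ((runs_walkLoop hB s.prec _ rfl).seq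
      ((runs_num (.lit 0)).seq ((runs_cnt (.var 10)).seq
        ((runs_readLoop hB s.prec _ rfl).seq (h1 _)))))))
  refine h2.cast ?_ ?_
  · have e : s.ptr + s.prec + s.prec = s.ptr + 2 * s.prec := by ring
    simp only [Expr.eval, mem_scalar, roundState, dropBits_dropBits, e, Nat.add_comm s.prec s.ptr]
    rfl
  · simp only [Expr.cost]; omega

lemma runs_coinLoop (hB : ∀ i, B 5 i 0 = (R i).toNat) (c k : ℕ) (s : Regs) (hs : s.rnd = k) :
    ∃ pos num cnt, Runs (.loop (.var 21) (coinRound c)) (s.mem B) (k * (120 * s.prec + 120) + 4)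
      (Regs.mem B { s with
        rnd := 0, pos := pos, num := num, cnt := cnt, ptr := s.ptr + 2 * s.prec * k
        st := coinState s.prec (s.load (B 6 s.i c)) k s.st (dropBits s.ptr R) }) := by
  induction k generalizing s with
  | zero =>
    refine ⟨s.pos, s.num, s.cnt,
      (Runs.loop_done (by simpa [Expr.eval, mem_scalar] using hs)).cast ?_ (by simp [Expr.cost])⟩
    cases s; cases hs; rfl
  | succ k ih =>
    obtain ⟨pos, num, cnt, h⟩ := ih { s with
        rnd := s.rnd - 1
        pos := walk s.prec 1 (dropBits s.ptr R)
        cnt := 0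
        num := readNum s.prec 0 (dropBits s.prec (dropBits s.ptr R))
        ptr := s.ptr + 2 * s.prec
        st := roundState s.prec (s.load (B 6 s.i c)) s.st (dropBits s.ptr R) } (by simp [hs])
    refine ⟨pos, num, cnt, (Runs.loop_step (by simp [Expr.eval, mem_scalar, hs])
      (runs_coinRound hB c s) h).cast ?_ ?_⟩
    · have e : s.ptr + 2 * s.prec + 2 * s.prec * k = s.ptr + (2 * s.prec * k + 2 * s.prec) := by
        ring
      simp only [coinState, dropBits_dropBits, Nat.mul_succ, e, Nat.add_comm (2 * s.prec) s.ptr]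
    · simp only [Expr.cost, Nat.succ_mul]; omega

lemma runs_coinProgram (hB : ∀ i, B 5 i 0 = (R i).toNat) (c : ℕ) (s : Regs) :
    ∃ pos num cnt st, Runs (coinProgram c) (s.mem B) (s.prec * (120 * s.prec + 120) + 40)
      (Regs.mem B { s with
        rnd := 0, pos := pos, num := num, cnt := cnt, st := st
        ptr := s.ptr + 2 * s.prec * s.prec
        acc := if coin s.prec (s.load (B 6 s.i c)) s.prec (dropBits s.ptr R) then s.acc
          else 0 }) := by
  have h1 : ∀ s : Regs, Runs (.ite (.sub (.var 19) (.lit 1)) .skip (.assign 20 (.lit 0)))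
      (s.mem B) 20 (Regs.mem B { s with acc := if 1 < s.st then s.acc else 0 }) := by
    intro s
    refine (Runs.ite (T := 10) (fun h => ?_) fun h => ?_).mono (by simp [Expr.cost])
    · simp only [Expr.eval, mem_scalar] at h
      rw [if_pos (by omega)]
      exact (Runs.skip _).mono (by simp)
    · simp only [Expr.eval, mem_scalar] at h
      rw [if_neg (by omega)]
      exact (runs_acc _).mono (by simp [Expr.cost])
  obtain ⟨pos, num, cnt, h⟩ := runs_coinLoop hB c s.prec { s with st := 0, rnd := s.prec } rfl
  have h2 := (runs_st (B := B) (s := s) (.lit 0)).seq ((runs_rnd (.var 10)).seq (h.seq (h1 _)))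
  simp only [one_lt_coinState] at h2
  exact ⟨pos, num, cnt, _, h2.mono (by simp only [Expr.cost]; omega)⟩

end CoinProgram

/-! ### The program for one arrival -/

section SchemeProgram

variable {B : Memory} {R : ℕ → Bool}

/-- Select the current arrival if it is active, accepted, and both its endpoints are free. -/
def matchProgram : Program :=
  .ite (.var 20)
    (.ite (.add (.get 9 (endExpr 0) (.lit 0)) (.get 9 (endExpr 1) (.lit 0))) .skip
      (.seq (.assign 7 (.lit 1)) (.seq (.set 9 (endExpr 0) (.lit 0) (.lit 1))
        (.set 9 (endExpr 1) (.lit 0) (.lit 1)))))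
    .skip

/-- Add the scaled value of the current arrival to the load of its endpoint number `c`. -/
abbrev loadProgram (c : ℕ) : Program :=
  .set 8 (endExpr c) (.lit 0) (.add (.get 8 (endExpr c) (.lit 0)) (.var 14))

/-- Prepare the division of the numerator of the value of the current arrival. -/
def prepareProgram : Program :=
  .seq (.decr 12) (.seq (.assign 13 (.get 3 (endExpr 0) (endExpr 1))) (.seq (.assign 14 (.lit 0))
    (.assign 15 (.var 10))))

/-- Process one arrival. -/
def arrivalProgram : Program :=
  .seq prepareProgram (.seq divLoop (.seq (.assign 20 (endExpr 2)) (.seq (coinProgram 0)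
    (.seq (coinProgram 1) (.seq (.assign 7 (.lit 0)) (.seq matchProgram
    (.seq (loadProgram 0) (.seq (loadProgram 1) (.incr 11)))))))))

lemma runs_load {s : Regs} (i e : Expr) : Runs (.set 8 i (.lit 0) e) (s.mem B)
    (i.cost + e.cost + 2) (Regs.mem B { s with
      load := Function.update s.load (i.eval (s.mem B)) (e.eval (s.mem B)) }) :=
  Runs.set_of_eq (write_load _ _) (by simp only [Expr.cost]; omega)

lemma runs_taken {s : Regs} (i e : Expr) : Runs (.set 9 i (.lit 0) e) (s.mem B)
    (i.cost + e.cost + 2) (Regs.mem B { s with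
      taken := Function.update s.taken (i.eval (s.mem B)) (e.eval (s.mem B)) }) :=
  Runs.set_of_eq (write_taken _ _) (by simp only [Expr.cost]; omega)

lemma runs_matchProgram (s : Regs) {u v : ℕ} (hu : B 6 s.i 0 = u) (hv : B 6 s.i 1 = v)
    (A : Prop) [Decidable A] (hA : A ↔ s.acc ≠ 0 ∧ s.taken u = 0 ∧ s.taken v = 0) :
    Runs matchProgram (s.mem B) 60 (Regs.mem B { s with
      out := if A then 1 else s.out
      taken := if A then Function.update (Function.update s.taken u 1) v 1 else s.taken }) := by
  have hf : ¬ A → (s.mem B) = (Regs.mem B { s with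
      out := if A then 1 else s.out
      taken := if A then Function.update (Function.update s.taken u 1) v 1 else s.taken }) := by
    intro h
    rw [if_neg h, if_neg h]
  refine (Runs.ite (T := 50) (fun h => ?_) fun h => ?_).mono (by simp [Expr.cost])
  · simp only [Expr.eval, mem_scalar] at h
    refine (Runs.ite (T := 30) (fun h' => ?_) fun h' => ?_).mono (by simp [Expr.cost])
    · simp only [Expr.eval, mem_scalar, mem_array, mem_vertex, hu, hv] at h'
      refine (Runs.skip _).cast (hf ?_) (by simp)
      rw [hA]; omega
    · simp only [Expr.eval, mem_scalar, mem_array, mem_vertex, hu, hv] at h'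
      have hA' : A := hA.2 ⟨h, by omega, by omega⟩
      refine ((runs_out _).seq ((runs_taken _ _).seq (runs_taken _ _))).cast ?_
        (by simp [Expr.cost])
      simp only [Expr.eval, mem_scalar, mem_array, hu, hv, if_pos hA']
  · simp only [Expr.eval, mem_scalar] at h
    refine (Runs.skip _).cast (hf ?_) (by simp)
    rw [hA]; omega

variable {n : ℕ} {z : Sym2 (Fin n) → ℕ} {K : ℕ}

/-- The variables hold the state of the scheme after a history, given with the most recent arrival
first. -/
structure Represents (z : Sym2 (Fin n) → ℕ) (K : ℕ) (R : ℕ → Bool) (h : History n)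
    (s : Regs) : Prop where
  prec : s.prec = K
  i : s.i = h.length
  ptr : s.ptr = h.length * (2 * (2 * K * K))
  load : ∀ v : Fin n, s.load v = load z (h.map Prod.fst) v
  taken : ∀ v : Fin n, s.taken v = (taken z K R h v).toNat
  out : s.out = (chooses z K R h).toNat

lemma mem_iff_eq_inf_or_sup {e : Sym2 (Fin n)} {v : Fin n} : v ∈ e ↔ v = e.inf ∨ v = e.sup := by
  conv_lhs => rw [← mk_inf_sup e]
  exact Sym2.mem_iff

lemma runs_prepareProgram (s : Regs) : Runs prepareProgram (s.mem B) 60 (Regs.mem B { s with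
    j := s.j - 1, rest := B 3 (B 6 s.i 0) (B 6 s.i 1), quot := 0, cnt := s.prec }) := by
  refine ((runs_j _).seq ((runs_rest _).seq ((runs_quot _).seq (runs_cnt _)))).cast ?_
    (by simp [Expr.cost])
  simp only [Expr.eval, mem_scalar, mem_array]

/-- The effect of processing an arrival with endpoints `u`, `v` and state `b`. -/
lemma runs_arrivalProgram_eq (hB : ∀ i, B 5 i 0 = (R i).toNat) (s : Regs) {u v b : ℕ}
    (hu : B 6 s.i 0 = u) (hv : B 6 s.i 1 = v) (hb : B 6 s.i 2 = b) (A : Prop) [Decidable A]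
    (hA : A ↔ (b ≠ 0 ∧ coin s.prec (s.load u) s.prec (dropBits s.ptr R) = true ∧
      coin s.prec (s.load v) s.prec (dropBits (s.ptr + 2 * s.prec * s.prec) R) = true) ∧
        s.taken u = 0 ∧ s.taken v = 0) (c : ℕ)
    (hc : (longDiv (B 4 u v) s.prec (B 3 u v, 0)).2 = c) :
    ∃ s' : Regs, Runs arrivalProgram (s.mem B) (500 * (s.prec + 1) ^ 2) (s'.mem B) ∧
      s'.out = (if A then 1 else 0) ∧
      s'.load = Function.update (Function.update s.load u (s.load u + c)) v
        (Function.update s.load u (s.load u + c) v + c) ∧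
      s'.taken = (if A then Function.update (Function.update s.taken u 1) v 1 else s.taken) ∧
      s'.prec = s.prec ∧ s'.i = s.i + 1 ∧ s'.j = s.j - 1 ∧
      s'.ptr = s.ptr + 2 * (2 * s.prec * s.prec) := by
  have g1 := runs_prepareProgram (B := B) s
  have g2 := runs_divLoop (B := B) s.prec _ (rfl : (Regs.cnt { s with
    j := s.j - 1, rest := B 3 (B 6 s.i 0) (B 6 s.i 1), quot := 0, cnt := s.prec }) = s.prec)
  have g3 := runs_acc (B := B) (s := { s with
    j := s.j - 1, rest := (longDiv (B 4 (B 6 s.i 0) (B 6 s.i 1)) s.prec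
      (B 3 (B 6 s.i 0) (B 6 s.i 1), 0)).1, quot := (longDiv (B 4 (B 6 s.i 0) (B 6 s.i 1)) s.prec
      (B 3 (B 6 s.i 0) (B 6 s.i 1), 0)).2, cnt := 0 }) (endExpr 2)
  simp only [Expr.eval, mem_scalar, mem_array, hu, hv, hb, hc] at g1 g2 g3
  obtain ⟨pos₁, num₁, cnt₁, st₁, g4⟩ := runs_coinProgram hB 0 { s with
    j := s.j - 1, rest := (longDiv (B 4 u v) s.prec (B 3 u v, 0)).1, quot := c, cnt := 0, acc := b }
  obtain ⟨pos₂, num₂, cnt₂, st₂, g5⟩ := runs_coinProgram hB 1 { s with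
    j := s.j - 1, rest := (longDiv (B 4 u v) s.prec (B 3 u v, 0)).1, quot := c, cnt := cnt₁
    acc := if coin s.prec (s.load u) s.prec (dropBits s.ptr R) = true then b else 0
    ptr := s.ptr + 2 * s.prec * s.prec, pos := pos₁, num := num₁, st := st₁, rnd := 0 }
  simp only [hu, hv] at g4 g5
  refine ⟨_, (g1.seq (g2.seq (g3.seq (g4.seq (g5.seq ((runs_out (.lit 0)).seq
    ((runs_matchProgram _ (u := u) (v := v) ?_ ?_ A ?_).seq ((runs_load (endExpr 0) _).seq
      ((runs_load (endExpr 1) _).seq (runs_i (.add (.var 11) (.lit 1)))))))))))).mono ?_,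
    rfl, ?_, rfl, rfl, rfl, rfl, ?_⟩
  · exact hu
  · exact hv
  · rw [hA]
    simp only
    split_ifs <;> simp_all
  · simp only [Expr.cost]
    nlinarith
  · simp only [Expr.eval, mem_scalar, mem_array, mem_vertex, hu, hv]
  · ring

lemma runs_arrivalProgram (hB : ∀ i, B 5 i 0 = (R i).toNat) {h : History n} {s : Regs}
    (hs : Represents z K R h s) {e : Sym2 (Fin n)} {b : Bool} (hne : e.inf ≠ e.sup)
    (h0 : B 6 h.length 0 = (e.inf : Fin n)) (h1 : B 6 h.length 1 = (e.sup : Fin n))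
    (h2 : B 6 h.length 2 = b.toNat)
    (hz : (longDiv (B 4 (e.inf : Fin n) (e.sup : Fin n)) K
      (B 3 (e.inf : Fin n) (e.sup : Fin n), 0)).2 = z e) :
    ∃ s', Runs arrivalProgram (s.mem B) (500 * (K + 1) ^ 2) (s'.mem B) ∧
      Represents z K R ((e, b) :: h) s' ∧ s'.j = s.j - 1 := by
  obtain ⟨hK, hi, hptr, hload, htaken, hout⟩ := hs
  subst hK
  rw [← hi] at h0 h1 h2
  have hacc : accepts z s.prec R (h.map Prod.fst) e =
      (coin s.prec (s.load (e.inf : Fin n)) s.prec (dropBits s.ptr R) &&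
        coin s.prec (s.load (e.sup : Fin n)) s.prec
          (dropBits (s.ptr + 2 * s.prec * s.prec) R)) := by
    rw [accepts, twoCoins, hload, hload, List.length_map, ← hptr, dropBits_dropBits,
      Nat.add_comm s.ptr]
  obtain ⟨s', hr, ho, hl, ht, hp, hi', hj, hq⟩ := runs_arrivalProgram_eq hB s h0 h1 h2
    (chooses z s.prec R ((e, b) :: h) = true) (by
      rw [chooses, hacc, htaken, htaken]
      simp [and_assoc]) (z e) hz
  refine ⟨s', hr, ⟨hp, by simp [hi', hi], ?_, ?_, ?_, ?_⟩, hj⟩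
  · rw [hq, hptr, List.length_cons]; ring
  · intro v
    have hne' : (e.inf : Fin n).val ≠ (e.sup : Fin n).val := fun h => hne (Fin.ext h)
    rw [hl, List.map_cons, Contention.load, ← hload v]
    simp only [mem_iff_eq_inf_or_sup, Function.update_apply, Fin.val_inj]
    by_cases hv1 : v = e.inf
    · subst hv1; simp [hne]
    · by_cases hv2 : v = e.sup
      · subst hv2; simp [hne.symm]
      · simp [hv1, hv2]
  · intro v
    rw [ht, Contention.taken]
    have hmatch : ∀ t : Fin n → Bool, matchUp e t v =
        (t v || (decide (v = e.inf ∨ v = e.sup) && (!t e.inf && !t e.sup))) := by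
      intro t
      conv_lhs => rw [← mk_inf_sup e]
      exact matchUp_apply_mk _ _ _ _
    have hcho : chooses z s.prec R ((e, b) :: h) = (b && accepts z s.prec R (h.map Prod.fst) e &&
      (!Contention.taken z s.prec R h e.inf && !Contention.taken z s.prec R h e.sup)) := rfl
    by_cases hc : (b && accepts z s.prec R (h.map Prod.fst) e) = true
    · rw [if_pos hc, hmatch]
      rw [hc, Bool.true_and] at hcho
      by_cases hf : (!Contention.taken z s.prec R h e.inf &&
          !Contention.taken z s.prec R h e.sup) = true
      · rw [hf] at hcho
        rw [if_pos hcho, hf]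
        simp only [Bool.and_true, Function.update_apply, Fin.val_inj, htaken]
        by_cases hv1 : v = e.inf <;> by_cases hv2 : v = e.sup <;> simp [hv1, hv2]
      · rw [Bool.not_eq_true] at hf
        rw [hf] at hcho
        rw [if_neg (by simp [hcho]), hf]
        simp [htaken]
    · rw [if_neg hc]
      rw [Bool.not_eq_true] at hc
      rw [hc, Bool.false_and] at hcho
      rw [if_neg (by simp [hcho]), htaken]
  · rw [ho]
    cases chooses z s.prec R ((e, b) :: h) <;> rfl

/-! ### The whole program -/

/-- Double `rest` until it reaches the denominator of the pair `(i, j)`, and count the doublings in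
`prec`. -/
def logLoop : Program :=
  .loop (.sub (.get 4 (.var 11) (.var 12)) (.var 13))
    (.seq (.assign 13 (.add (.var 13) (.var 13))) (.incr 10))

/-- Add the lengths of the denominators of the pairs `(i, j')`, `j' < j`, to `prec`. -/
def rowLoop : Program :=
  .loop (.var 12) (.seq (.decr 12) (.seq (.assign 13 (.lit 1)) (.seq logLoop (.incr 10))))

/-- Add the lengths of the denominators of the pairs `(i', j)`, `i' < i`, to `prec`. -/
def tableLoop : Program :=
  .loop (.var 11) (.seq (.decr 11) (.seq (.assign 12 (.get 0 (.lit 0) (.lit 0))) rowLoop))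

/-- The program of the scheme: compute the precision, then replay all arrivals so far. -/
def schemeProgram : Program :=
  .seq (.assign 11 (.get 0 (.lit 0) (.lit 0))) (.seq tableLoop (.seq (.assign 11 (.lit 0))
    (.seq (.assign 12 (.get 1 (.lit 0) (.lit 0))) (.loop (.var 12) arrivalProgram))))

lemma runs_logLoop (k : ℕ) (s : Regs) (hk : ∀ m, B 4 s.i s.j ≤ s.rest * 2 ^ m ↔ k ≤ m) :
    ∃ r, Runs logLoop (s.mem B) (60 * k + 20)
      (Regs.mem B { s with rest := r, prec := s.prec + k }) := by
  induction k generalizing s with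
  | zero =>
    have := (hk 0).2 le_rfl
    rw [pow_zero, mul_one] at this
    exact ⟨s.rest, (Runs.loop_done (by
      simp only [Expr.eval, mem_scalar, mem_array]; omega)).mono (by simp [Expr.cost])⟩
  | succ k ih =>
    have h0 := (hk 0).not.2 (by omega)
    rw [pow_zero, mul_one] at h0
    have h2 := (runs_rest (B := B) (s := s) (.add (.var 13) (.var 13))).seq
      (runs_prec (.add (.var 10) (.lit 1)))
    simp only [Expr.eval, mem_scalar] at h2
    obtain ⟨r, hr⟩ := ih { s with rest := s.rest + s.rest, prec := s.prec + 1 } (fun m => by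
      have := hk (m + 1)
      rwa [pow_succ', ← mul_assoc, mul_two, Nat.succ_le_succ_iff] at this)
    refine ⟨r, (Runs.loop_step (by
      simp only [Expr.eval, mem_scalar, mem_array]; omega) h2 hr).cast ?_
        (by simp [Expr.cost]; omega)⟩
    congr 2; ring

lemma runs_rowLoop (m : ℕ) (s : Regs) (hm : s.j = m) :
    ∃ r, Runs rowLoop (s.mem B)
      (150 * (∑ j ∈ Finset.range m, (Nat.clog 2 (B 4 s.i j) + 1)) + 5)
      (Regs.mem B { s with
        rest := r
        j := 0
        prec := s.prec + ∑ j ∈ Finset.range m, (Nat.clog 2 (B 4 s.i j) + 1) }) := by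
  induction m generalizing s with
  | zero =>
    refine ⟨s.rest, (Runs.loop_done (by simpa [Expr.eval, mem_scalar] using hm)).cast ?_
      (by simp [Expr.cost])⟩
    cases s; cases hm; rfl
  | succ m ih =>
    have h1 := (runs_j (B := B) (s := s) (.sub (.var 12) (.lit 1))).seq (runs_rest (.lit 1))
    simp only [Expr.eval, mem_scalar, hm, Nat.add_sub_cancel] at h1
    obtain ⟨r, hr⟩ := runs_logLoop (B := B) (Nat.clog 2 (B 4 s.i m)) { s with j := m, rest := 1 }
      (fun m' => by rw [one_mul]; exact (Nat.clog_le_iff_le_pow one_lt_two).symm)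
    have h2 := runs_prec (B := B)
      (s := { s with j := m, rest := r, prec := s.prec + Nat.clog 2 (B 4 s.i m) })
      (.add (.var 10) (.lit 1))
    simp only [Expr.eval, mem_scalar] at h2
    obtain ⟨r', hr'⟩ := ih { s with
      j := m, rest := r, prec := s.prec + Nat.clog 2 (B 4 s.i m) + 1 } rfl
    obtain ⟨t₁, ht₁, e₁⟩ := h1
    refine ⟨r', (Runs.loop_step (T₁ := 100 + 60 * Nat.clog 2 (B 4 s.i m))
      (by simp [Expr.eval, mem_scalar, hm]) ?_ hr').cast ?_ ?_⟩
    · cases e₁ with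
      | seq a b =>
        refine (Runs.seq ⟨_, le_rfl, a⟩ (Runs.seq ⟨_, le_rfl, b⟩ (hr.seq h2))).mono ?_
        simp only [Expr.cost] at ht₁ ⊢
        omega
    · congr 2
      rw [Finset.sum_range_succ]; ring
    · simp only [Expr.cost, Finset.sum_range_succ]
      omega

lemma runs_tableLoop (m : ℕ) (s : Regs) (hm : s.i = m) :
    ∃ r j, Runs tableLoop (s.mem B)
      (150 * (∑ i ∈ Finset.range m, ∑ j ∈ Finset.range (B 0 0 0),
        (Nat.clog 2 (B 4 i j) + 1)) + 40 * m + 5)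
      (Regs.mem B { s with
        rest := r
        i := 0
        j := j
        prec := s.prec + ∑ i ∈ Finset.range m, ∑ j ∈ Finset.range (B 0 0 0),
          (Nat.clog 2 (B 4 i j) + 1) }) := by
  induction m generalizing s with
  | zero =>
    refine ⟨s.rest, s.j, (Runs.loop_done (by simpa [Expr.eval, mem_scalar] using hm)).cast ?_
      (by simp [Expr.cost])⟩
    cases s; cases hm; rfl
  | succ m ih =>
    have h1 := runs_i (B := B) (s := s) (.sub (.var 11) (.lit 1))
    have h2 := runs_j (B := B) (s := { s with i := m }) (.get 0 (.lit 0) (.lit 0))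
    simp only [Expr.eval, mem_scalar, mem_array, hm, Nat.add_sub_cancel] at h1 h2
    obtain ⟨r, hr⟩ := runs_rowLoop (B := B) (B 0 0 0) { s with i := m, j := B 0 0 0 } rfl
    obtain ⟨r', j, hr'⟩ := ih { s with
      i := m, j := 0, rest := r
      prec := s.prec + ∑ j ∈ Finset.range (B 0 0 0), (Nat.clog 2 (B 4 m j) + 1) } rfl
    refine ⟨r', j, (Runs.loop_step (by simp [Expr.eval, mem_scalar, hm])
      (h1.seq (h2.seq hr)) hr').cast ?_ ?_⟩
    · congr 2
      rw [Finset.sum_range_succ]; ring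
    · simp only [Expr.cost, Finset.sum_range_succ]
      omega

/-- Replaying the arrivals of `l` after those of `h`. -/
lemma runs_arrivalLoop (hB : ∀ i, B 5 i 0 = (R i).toNat) (l : History n) {h : History n} {s : Regs}
    (hs : Represents z K R h s) (hj : s.j = l.length)
    (hl : ∀ k e b, l[k]? = some (e, b) → e.inf ≠ e.sup ∧
      B 6 (h.length + k) 0 = (e.inf : Fin n) ∧ B 6 (h.length + k) 1 = (e.sup : Fin n) ∧
      B 6 (h.length + k) 2 = b.toNat ∧ (longDiv (B 4 (e.inf : Fin n) (e.sup : Fin n)) K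
        (B 3 (e.inf : Fin n) (e.sup : Fin n), 0)).2 = z e) :
    ∃ s', Runs (.loop (.var 12) arrivalProgram) (s.mem B)
      ((500 * (K + 1) ^ 2 + 4) * l.length + 4) (s'.mem B) ∧
      Represents z K R (l.reverse ++ h) s' := by
  induction l generalizing h s with
  | nil =>
    exact ⟨s, (Runs.loop_done (by simpa [Expr.eval, mem_scalar] using hj)).mono
      (by simp [Expr.cost]), by simpa using hs⟩
  | cons a l ih =>
    obtain ⟨e, b⟩ := a
    obtain ⟨h1, h2, h3, h4, h5⟩ := hl 0 e b (by simp)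
    obtain ⟨s₁, r₁, hs₁, hj₁⟩ := runs_arrivalProgram hB hs h1 h2 h3 h4 h5
    obtain ⟨s₂, r₂, hs₂⟩ := ih hs₁ (by simp [hj₁, hj]) (fun k e' b' hk => by
      have := hl (k + 1) e' b' (by simpa using hk)
      rwa [← add_assoc, add_right_comm] at this)
    refine ⟨s₂, (Runs.loop_step (by simp [Expr.eval, mem_scalar, hj]) r₁ r₂).mono ?_,
      by simpa using hs₂⟩
    simp only [Expr.cost, List.length_cons]
    rw [Nat.mul_succ]
    omega

/-- The number of binary digits to which the program computes: the total length of the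
denominators of the edge values. -/
noncomputable def Input.precision (I : Input) (q : Sym2 (Fin I.n) → ℚ) : ℕ :=
  ∑ u, ∑ v, (Nat.clog 2 (q s(u, v)).den + 1)

/-- The edge values, scaled by `2 ^ K` and rounded down. As the long division produces no carry
above the first binary digit, the value `1` gives `2 ^ K - 1`. -/
def scaledValue {n : ℕ} (q : Sym2 (Fin n) → ℚ) (K : ℕ) (e : Sym2 (Fin n)) : ℕ :=
  (longDiv (q e).den K ((q e).num.toNat, 0)).2

lemma initialMemory_eq_mem (I : Input) (q : Sym2 (Fin I.n) → ℚ) {N : ℕ} (R : Fin N → Bool)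
    (h : History I.n) : initialMemory I q R h = Regs.mem (initialMemory I q R h)
      ⟨0, 0, 0, 0, 0, 0, 0, 0, 0, 0, 0, 0, 0, 0, 0⟩ := by
  funext a i j
  unfold Regs.mem
  split <;> simp [initialMemory]

lemma runs_schemeProgram (I : Input) (q : Sym2 (Fin I.n) → ℚ) {N : ℕ} (R : Fin N → Bool)
    (h : History I.n) (hh : ∀ a ∈ h, a.1 ∈ I.G.edgeSet) :
    ∃ τ, Runs schemeProgram (initialMemory I q R h)
      (150 * I.precision q + 40 * I.n + (500 * (I.precision q + 1) ^ 2 + 4) * h.length + 40) τ ∧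
      τ 7 0 0 =
        (chooses (scaledValue q (I.precision q)) (I.precision q) (padBits R) h.reverse).toNat := by
  have hB : ∀ i, initialMemory I q R h 5 i 0 = (padBits R i).toNat := by
    intro i
    by_cases hi : i < N <;> simp [initialMemory, padBits, hi]
  have hn : initialMemory I q R h 0 0 0 = I.n := by simp [initialMemory]
  have hm : initialMemory I q R h 1 0 0 = h.length := by simp [initialMemory]
  have hK : ∑ i ∈ Finset.range I.n, ∑ j ∈ Finset.range I.n,
      (Nat.clog 2 (initialMemory I q R h 4 i j) + 1) = I.precision q := by
    rw [Finset.sum_range, Input.precision]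
    refine Finset.sum_congr rfl fun u _ => ?_
    rw [Finset.sum_range]
    refine Finset.sum_congr rfl fun v _ => ?_
    simp [initialMemory]
  rw [initialMemory_eq_mem]
  generalize hBdef : initialMemory I q R h = B at *
  have g1 := runs_i (B := B) (s := ⟨0, 0, 0, 0, 0, 0, 0, 0, 0, 0, 0, 0, 0, 0, 0⟩)
    (.get 0 (.lit 0) (.lit 0))
  simp only [Expr.eval, mem_array, hn] at g1
  obtain ⟨r, j, g2⟩ := runs_tableLoop (B := B) I.n
    ⟨0, 0, 0, 0, I.n, 0, 0, 0, 0, 0, 0, 0, 0, 0, 0⟩ rfl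
  rw [hn, hK] at g2
  have g3 := (runs_i (B := B) (s := ⟨0, 0, 0, 0 + I.precision q, 0, j, r, 0, 0, 0, 0, 0, 0, 0, 0⟩)
    (.lit 0)).seq (runs_j (.get 1 (.lit 0) (.lit 0)))
  simp only [Expr.eval, mem_array, hm, zero_add] at g2 g3
  obtain ⟨s', g4, hs'⟩ := runs_arrivalLoop (z := scaledValue q (I.precision q))
    (K := I.precision q) hB h (h := [])
    (s := ⟨0, 0, 0, I.precision q, 0, h.length, r, 0, 0, 0, 0, 0, 0, 0, 0⟩)
    ⟨rfl, rfl, by simp, fun v => by simp [Contention.load], fun v => by simp [Contention.taken],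
      by simp [chooses]⟩ rfl (fun k e b hk => by
        have he : e ∈ I.G.edgeSet := hh _ (List.mem_of_getElem? hk)
        refine ⟨fun hne => ?_, ?_, ?_, ?_, ?_⟩
        · rw [← mk_inf_sup e, SimpleGraph.mem_edgeSet, hne] at he
          exact I.G.loopless.irrefl _ he
        · simp [← hBdef, initialMemory, hk]
        · simp [← hBdef, initialMemory, hk]
        · simp [← hBdef, initialMemory, hk]
        · simp [← hBdef, initialMemory, scaledValue, mk_inf_sup])
  obtain ⟨t₃, ht₃, e₃⟩ := g3
  cases e₃ with
  | seq a b =>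
    refine ⟨_, (g1.seq (g2.seq (Runs.seq ⟨_, le_rfl, a⟩
      (Runs.seq ⟨_, le_rfl, b⟩ g4)))).mono ?_, by simpa [mem_scalar] using hs'.out⟩
    simp only [Expr.cost] at ht₃ ⊢
    omega

lemma clog_two_le_size (d : ℕ) : Nat.clog 2 d ≤ d.size :=
  Nat.clog_le_of_le_pow (Nat.lt_size_self d).le

lemma Input.precision_le_bitLength (I : Input) (q : Sym2 (Fin I.n) → ℚ) :
    I.precision q ≤ I.bitLength q := by
  refine Finset.sum_le_sum fun u _ => Finset.sum_le_sum fun v _ => ?_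
  have := clog_two_le_size (q s(u, v)).den
  omega

lemma Input.sq_le_precision (I : Input) (q : Sym2 (Fin I.n) → ℚ) : I.n * I.n ≤ I.precision q := by
  have : ∑ _u : Fin I.n, ∑ _v : Fin I.n, 1 = I.n * I.n := by simp
  rw [← this]
  exact Finset.sum_le_sum fun u _ => Finset.sum_le_sum fun v _ => by omega

/-- The `n ^ 2` extra digits more than make up for the `n` rounding errors at a vertex. -/
lemma Input.mul_den_le (I : Input) (q : Sym2 (Fin I.n) → ℚ) (e : Sym2 (Fin I.n)) :
    I.n * (q e).den ≤ 2 ^ I.precision q := by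
  have h : I.n + Nat.clog 2 (q e).den ≤ I.precision q := by
    have h1 : ∀ u, I.n ≤ ∑ v, (Nat.clog 2 (q s(u, v)).den + 1) := fun u => by
      rw [Finset.sum_add_distrib]; simp
    have h2 : I.n + Nat.clog 2 (q e).den ≤ ∑ v, (Nat.clog 2 (q s(e.inf, v)).den + 1) := by
      rw [Finset.sum_add_distrib]
      have := Finset.single_le_sum (f := fun v => Nat.clog 2 (q s(e.inf, v)).den)
        (fun _ _ => Nat.zero_le _) (Finset.mem_univ e.sup)
      simp only [mk_inf_sup] at this
      simp only [Finset.sum_const, Finset.card_univ, Fintype.card_fin, smul_eq_mul, mul_one]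
      omega
    exact h2.trans (Finset.single_le_sum
      (f := fun u => ∑ v, (Nat.clog 2 (q s(u, v)).den + 1))
      (fun _ _ => Nat.zero_le _) (Finset.mem_univ e.inf))
  calc I.n * (q e).den ≤ 2 ^ I.n * 2 ^ Nat.clog 2 (q e).den :=
        Nat.mul_le_mul Nat.lt_two_pow_self.le (Nat.le_pow_clog one_lt_two _)
    _ = 2 ^ (I.n + Nat.clog 2 (q e).den) := (pow_add _ _ _).symm
    _ ≤ _ := Nat.pow_le_pow_right two_pos h

lemma length_le_sq_of_nodup {n : ℕ} {l : List (Sym2 (Fin n))} (h : l.Nodup) :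
    l.length ≤ n * n := by
  have h1 := List.Nodup.length_le_card h
  have h2 : Fintype.card (Sym2 (Fin n)) ≤ Fintype.card (Fin n × Fin n) :=
    Fintype.card_le_of_surjective (fun p : Fin n × Fin n => s(p.1, p.2)) fun e =>
      ⟨(e.inf, e.sup), mk_inf_sup e⟩
  simpa using h1.trans h2

/-- On legal histories the program computes the decisions of the scheme. -/
lemma policy_schemeProgram (I : Input) (q : Sym2 (Fin I.n) → ℚ) {N : ℕ} (R : Fin N → Bool)
    (h : History I.n) (hh : ∀ a ∈ h, a.1 ∈ I.G.edgeSet) :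
    schemeProgram.policy I q R h =
      chooses (scaledValue q (I.precision q)) (I.precision q) (padBits R) h.reverse := by
  obtain ⟨τ, ⟨t, ht, e⟩, hτ⟩ := runs_schemeProgram I q R h hh
  have : (∃ t τ, Exec schemeProgram (initialMemory I q R h) t τ ∧ τ 7 0 0 ≠ 0) ↔
      chooses (scaledValue q (I.precision q)) (I.precision q) (padBits R) h.reverse = true := by
    constructor
    · rintro ⟨t', τ', e', hne⟩
      rw [← e.unique e', hτ] at hne
      simpa using hne
    · intro hc
      exact ⟨t, τ, e, by simp [hτ, hc]⟩
  rw [Program.policy, Bool.eq_iff_iff]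
  exact (@decide_eq_true_iff _ (_)).trans this

/-- The number of steps is polynomial in the length of the input. -/
lemma schemeProgram_time (I : Input) (q : Sym2 (Fin I.n) → ℚ) {N : ℕ} (R : Fin N → Bool)
    (h : History I.n) (hd : (h.map Prod.fst).Nodup) (hh : ∀ a ∈ h, a.1 ∈ I.G.edgeSet) :
    ∃ t τ, Exec schemeProgram (initialMemory I q R h) t τ ∧
      t ≤ 1000 * (I.bitLength q + 1) ^ 3 := by
  obtain ⟨τ, ⟨t, ht, e⟩, -⟩ := runs_schemeProgram I q R h hh
  refine ⟨t, τ, e, ht.trans ?_⟩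
  have h1 : h.length ≤ I.precision q := by
    have := length_le_sq_of_nodup hd
    rw [List.length_map] at this
    exact this.trans (I.sq_le_precision q)
  have h2 := I.precision_le_bitLength q
  have h3 : I.n ≤ I.precision q := (Nat.le_mul_self _).trans (I.sq_le_precision q)
  generalize I.precision q = K at *
  generalize I.bitLength q = L at *
  calc 150 * K + 40 * I.n + (500 * (K + 1) ^ 2 + 4) * h.length + 40
      ≤ 150 * L + 40 * L + (500 * (L + 1) ^ 2 + 4) * L + 40 := by
        gcongr <;> omega
    _ ≤ _ := by nlinarith [sq_nonneg L, Nat.zero_le (L ^ 3)]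

end SchemeProgram

/-! ### The online contention resolution scheme -/

section Scheme

/-- `ρ` is the scheme with the coins of `chooses`, for some approximation `z` of the edge values
with sufficient precision `K` and sufficiently many random bits. -/
def IsCoinScheme (I : Input) (ρ : PMF (Policy I.n)) : Prop :=
  ∃ (N K : ℕ) (z : Sym2 (Fin I.n) → ℕ) (π : (Fin N → Bool) → Policy I.n),
    ρ = (PMF.uniformOfFintype (Fin N → Bool)).map π ∧
    (∀ R h, (∀ a ∈ h, a.1 ∈ I.G.edgeSet) → π R h = chooses z K (padBits R) h.reverse) ∧
    (∀ e, (z e : ℝ) ≤ I.x e * 2 ^ K) ∧ (∀ e, I.x e * 2 ^ K - 1 ≤ z e) ∧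
    (0 < I.maxValue → (I.n : ℝ) ≤ I.maxValue * 2 ^ K ∧ 1 ≤ I.maxValue * 2 ^ K) ∧
    I.n * I.n * (2 * (2 * K * K)) ≤ N

lemma Input.x_le_one (I : Input) (e : Sym2 (Fin I.n)) : I.x e ≤ 1 := by
  by_cases he : e ∈ I.G.edgeSet
  · have := I.load_le_one (l := [e]) (by simp) (by simpa using he) e.inf
    have hm : e.inf ∈ e := mem_iff_eq_inf_or_sup.2 (Or.inl rfl)
    simpa [load, hm] using this
  · rw [I.x_off e he]
    exact zero_le_one

lemma Input.maxValue_le_one (I : Input) : I.maxValue ≤ 1 :=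
  Real.iSup_le (fun e => I.x_le_one e) zero_le_one

lemma Input.exists_pos_of_maxValue_pos (I : Input) (h : 0 < I.maxValue) : ∃ e, 0 < I.x e := by
  by_contra! hc
  exact absurd (Real.iSup_le (fun e : I.G.edgeSet => hc e) le_rfl) (not_le.2 h)

/-- For real edge values the scheme exists, although no program computes it. -/
lemma exists_isCoinScheme (I : Input) : ∃ ρ, IsCoinScheme I ρ := by
  obtain ⟨K, hK⟩ : ∃ K : ℕ, 0 < I.maxValue → (I.n : ℝ) + 1 ≤ I.maxValue * 2 ^ K := by
    by_cases h : 0 < I.maxValue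
    · obtain ⟨K, hK⟩ := pow_unbounded_of_one_lt ((I.n + 1) / I.maxValue) one_lt_two
      exact ⟨K, fun _ => by rw [div_lt_iff₀ h] at hK; linarith⟩
    · exact ⟨0, fun h' => absurd h' h⟩
  refine ⟨_, I.n * I.n * (2 * (2 * K * K)), K, fun e => ⌊I.x e * 2 ^ K⌋₊,
    fun R h => chooses (fun e => ⌊I.x e * 2 ^ K⌋₊) K (padBits R) h.reverse, rfl,
    fun _ _ _ => rfl, fun e => Nat.floor_le (mul_nonneg (I.x_nonneg e) (by positivity)),
    fun e => (Nat.sub_one_lt_floor _).le, fun h => ⟨?_, ?_⟩, le_rfl⟩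
  · linarith [hK h]
  · linarith [hK h, (Nat.cast_nonneg I.n : (0 : ℝ) ≤ I.n)]

section Rational

variable {I : Input} {q : Sym2 (Fin I.n) → ℚ} (hq : ∀ e, I.x e = q e)

include hq

lemma num_toNat_div_den (e : Sym2 (Fin I.n)) :
    (((q e).num.toNat : ℕ) : ℝ) / (q e).den = I.x e := by
  have h0 : 0 ≤ (q e).num := by
    rw [Rat.num_nonneg]
    exact_mod_cast hq e ▸ I.x_nonneg e
  have h1 : (((q e).num.toNat : ℕ) : ℝ) = ((q e).num : ℝ) := by
    exact_mod_cast congrArg (Int.cast (R := ℝ)) (Int.toNat_of_nonneg h0)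
  rw [h1, hq e]
  exact_mod_cast congrArg (Rat.cast (K := ℝ)) (Rat.num_div_den (q e))

lemma scaledValue_bounds (K : ℕ) (e : Sym2 (Fin I.n)) :
    (scaledValue q K e : ℝ) ≤ I.x e * 2 ^ K ∧ I.x e * 2 ^ K - 1 ≤ scaledValue q K e := by
  have hd : (0 : ℝ) < (q e).den := by exact_mod_cast (q e).den_pos
  have h := num_toNat_div_den hq e
  rw [div_eq_iff hd.ne'] at h
  have hle : (q e).num.toNat ≤ (q e).den := by
    have : (((q e).num.toNat : ℕ) : ℝ) ≤ (q e).den := by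
      rw [h]; nlinarith [I.x_le_one e]
    exact_mod_cast this
  obtain ⟨h1, h2⟩ := longDiv_spec (q e).den K (q e).num.toNat 0 hle
  have h1' : (scaledValue q K e : ℝ) * (q e).den +
      ((longDiv (q e).den K ((q e).num.toNat, 0)).1 : ℕ) = I.x e * (q e).den * 2 ^ K := by
    rw [← h]
    have := congrArg (Nat.cast (R := ℝ)) h1
    push_cast at this
    rw [scaledValue]
    linarith
  have h2' : (((longDiv (q e).den K ((q e).num.toNat, 0)).1 : ℕ) : ℝ) ≤ (q e).den := by
    exact_mod_cast h2
  have h3 : (0 : ℝ) ≤ ((longDiv (q e).den K ((q e).num.toNat, 0)).1 : ℕ) := Nat.cast_nonneg _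
  constructor
  · refine le_of_mul_le_mul_right ?_ hd
    linarith
  · refine le_of_mul_le_mul_right ?_ hd
    linarith

lemma le_maxValue_mul_two_pow (h : 0 < I.maxValue) :
    (I.n : ℝ) ≤ I.maxValue * 2 ^ I.precision q ∧ 1 ≤ I.maxValue * 2 ^ I.precision q := by
  obtain ⟨e, he⟩ := I.exists_pos_of_maxValue_pos h
  have hd : (0 : ℝ) < (q e).den := by exact_mod_cast (q e).den_pos
  have h1 := num_toNat_div_den hq e
  rw [div_eq_iff hd.ne'] at h1
  have h2 : 1 ≤ (q e).num.toNat := by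
    have : (0 : ℝ) < ((q e).num.toNat : ℕ) := by rw [h1]; positivity
    exact_mod_cast this
  have h3 : (1 : ℝ) ≤ I.x e * (q e).den := by rw [← h1]; exact_mod_cast h2
  have h4 : (I.n : ℝ) * (q e).den ≤ 2 ^ I.precision q := by exact_mod_cast I.mul_den_le q e
  have h5 : (I.n : ℝ) ≤ I.maxValue * 2 ^ I.precision q := by
    have hn : (0 : ℝ) ≤ I.n := Nat.cast_nonneg _
    calc (I.n : ℝ) ≤ I.n * (I.x e * (q e).den) := le_mul_of_one_le_right hn h3
      _ = I.x e * (I.n * (q e).den) := by ring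
      _ ≤ I.maxValue * 2 ^ I.precision q :=
        mul_le_mul (I.x_le_maxValue e) h4 (by positivity) h.le
  refine ⟨h5, le_trans ?_ h5⟩
  have : 0 < I.n := e.inf.pos
  exact_mod_cast this

/-- For rational edge values the scheme is computed by `schemeProgram`. -/
lemma isCoinScheme_schemeProgram {N : ℕ} (hN : 4 * I.bitLength q ^ 3 ≤ N) :
    IsCoinScheme I ((PMF.uniformOfFintype (Fin N → Bool)).map fun R =>
      schemeProgram.policy I q R) := by
  refine ⟨N, I.precision q, scaledValue q (I.precision q), _, rfl,
    fun R h hh => policy_schemeProgram I q R h hh, fun e => (scaledValue_bounds hq _ e).1,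
    fun e => (scaledValue_bounds hq _ e).2, fun h => le_maxValue_mul_two_pow hq h, ?_⟩
  have h1 := I.precision_le_bitLength q
  calc I.n * I.n * (2 * (2 * I.precision q * I.precision q))
      ≤ I.bitLength q * (2 * (2 * I.bitLength q * I.bitLength q)) := by
        gcongr
        exact (I.sq_le_precision q).trans h1
    _ = 4 * I.bitLength q ^ 3 := by ring
    _ ≤ N := hN

end Rational

lemma IsCoinScheme.valid {I : Input} {ρ : PMF (Policy I.n)} (hρ : IsCoinScheme I ρ)
    {π : Policy I.n} (hπ : π ∈ ρ.support) {order : List (Sym2 (Fin I.n))}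
    (ho : IsArrivalOrder I order) (S : Finset (Sym2 (Fin I.n))) :
    selected π order S ⊆ S ∧ IsMatching (selected π order S) := by
  obtain ⟨N, K, z, p, rfl, hp, -⟩ := hρ
  obtain ⟨R, -, rfl⟩ := (PMF.mem_support_map_iff _ _ _).1 hπ
  refine selected_valid (z := z) (K := K) (R := padBits R) fun l e hle => hp R _ fun a ha => ?_
  obtain ⟨f, hf, rfl⟩ := List.mem_map.1 ha
  exact (ho.2 f).1 (hle.subset hf)

lemma bitE_ind_le_toReal_toOuterMeasure_map {β : Type*} {N : ℕ} (p : (Fin N → Bool) → β)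
    (A : Set β) (c : (ℕ → Bool) → Bool) (h : ∀ R, c (padBits R) = true → p R ∈ A) :
    bitE N (fun R => ind (c R)) ≤
      (((PMF.uniformOfFintype (Fin N → Bool)).map p).toOuterMeasure A).toReal := by
  classical
  rw [PMF.toOuterMeasure_map_apply, PMF.toOuterMeasure_uniformOfFintype_apply, bitE_eq_sum,
    ENNReal.toReal_div, ENNReal.toReal_natCast, ENNReal.toReal_natCast, Fintype.card_fun,
    Fintype.card_bool, Fintype.card_fin]
  push_cast
  gcongr
  rw [Fintype.card_subtype, Finset.card_filter]
  push_cast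
  refine Finset.sum_le_sum fun R _ => ?_
  by_cases hc : c (padBits R) = true
  · have : R ∈ p ⁻¹' A := h R hc
    simp [ind, hc, this]
  · rw [ind, if_neg hc]
    split_ifs <;> norm_num

lemma Input.stateProb_eq_activeProb (I : Input) (S : Finset (Sym2 (Fin I.n))) :
    I.stateProb S = activeProb I.x (by classical exact I.G.edgeFinset) S := by
  unfold Input.stateProb activeProb
  congr

lemma Input.stateProb_nonneg (I : Input) (S : Finset (Sym2 (Fin I.n))) : 0 ≤ I.stateProb S :=
  mul_nonneg (Finset.prod_nonneg fun e _ => I.x_nonneg e)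
    (Finset.prod_nonneg fun e _ => sub_nonneg.2 (I.x_le_one e))

/-- If the edge has the value `0`, there is nothing to prove; otherwise `maxValue` is positive,
and the precision suffices. -/
lemma selectableOn_of_isCoinScheme (ψ : OCRS) {I : Input} (hψ : IsCoinScheme I (ψ.rule I)) :
    ψ.SelectableOn (goldenAlpha - 1200 * I.maxValue ^ (1 / 20 : ℝ)) I := by
  classical
  intro order ho e he
  obtain ⟨N, K, z, p, hρ, hp, hz, hz', hK, hN⟩ := hψ
  rcases (I.x_nonneg e).eq_or_lt with h0 | h0
  · rw [← h0, mul_zero]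
    exact Finset.sum_nonneg fun S _ => mul_nonneg (I.stateProb_nonneg S) ENNReal.toReal_nonneg
  have hε := h0.trans_le (I.x_le_maxValue e)
  obtain ⟨l, l', rfl⟩ := List.append_of_mem ((ho.2 e).2 he)
  have hnd : (e :: l.reverse).Nodup := by
    have h1 : (l ++ [e]).Nodup :=
      ho.1.sublist (by rw [← List.singleton_append, ← List.append_assoc]; simp)
    have h2 := List.nodup_reverse.2 h1
    simpa using h2
  have hlen := length_le_sq_of_nodup hnd
  rw [List.length_cons] at hlen
  refine (I.le_sum_activeProb_chooses (E := I.G.edgeFinset) (by simp) hz hz' hε I.maxValue_le_one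
    (hK hε).1 (hK hε).2 hnd (fun f hf => (ho.2 f).1 ?_)
    ((Nat.mul_le_mul_right _ hlen).trans hN)).trans ?_
  · simp only [List.mem_cons, List.mem_reverse] at hf
    simp only [List.mem_append, List.mem_cons]
    tauto
  · refine Finset.sum_le_sum fun S _ => ?_
    rw [I.stateProb_eq_activeProb, hρ]
    refine mul_le_mul_of_nonneg_left ?_ (I.stateProb_eq_activeProb S ▸ I.stateProb_nonneg S)
    refine bitE_ind_le_toReal_toOuterMeasure_map p _ _ fun R hc => ?_
    refine ⟨l, ⟨l', by simp⟩, ?_⟩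
    rw [hp R, history_reverse]
    · exact hc
    · intro a ha
      obtain ⟨f, hf, rfl⟩ := List.mem_map.1 ha
      refine (ho.2 f).1 ?_
      simp only [List.mem_append, List.mem_cons, List.not_mem_nil, or_false] at hf ⊢
      tauto

/-- The scheme exists on every input, and on rational inputs it is the one that the program
computes; the rational values `q` are determined by the input. -/
lemma exists_isCoinScheme_schemeProgram (I : Input) : ∃ ρ, IsCoinScheme I ρ ∧
    ∀ q : Sym2 (Fin I.n) → ℚ, (∀ e, I.x e = q e) →
      ρ = (PMF.uniformOfFintype
        (Fin ((4 * Polynomial.X ^ 3 : Polynomial ℕ).eval (I.bitLength q)) → Bool)).map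
          fun R => schemeProgram.policy I q R := by
  by_cases h : ∃ q : Sym2 (Fin I.n) → ℚ, ∀ e, I.x e = q e
  · obtain ⟨q, hq⟩ := h
    refine ⟨_, isCoinScheme_schemeProgram hq
      (N := (4 * Polynomial.X ^ 3 : Polynomial ℕ).eval (I.bitLength q)) (by simp), ?_⟩
    intro q' hq'
    obtain rfl : q = q' := funext fun e => by exact_mod_cast (hq e).symm.trans (hq' e)
    rfl
  · obtain ⟨ρ, hρ⟩ := exists_isCoinScheme I
    exact ⟨ρ, hρ, fun q hq => absurd ⟨q, hq⟩ h⟩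

/-- The scheme on all inputs: computed by `schemeProgram` if the edge values are rational. -/
noncomputable def coinOCRS : OCRS where
  rule I := (exists_isCoinScheme_schemeProgram I).choose
  valid I _ hπ _ ho S _ := (exists_isCoinScheme_schemeProgram I).choose_spec.1.valid hπ ho S

lemma polyTime_coinOCRS : coinOCRS.PolyTime := by
  refine ⟨schemeProgram, 1000 * (Polynomial.X + 1) ^ 3, 4 * Polynomial.X ^ 3, fun I q hq =>
    ⟨(exists_isCoinScheme_schemeProgram I).choose_spec.2 q hq, fun R h hd hh => ?_⟩⟩
  obtain ⟨t, τ, e, ht⟩ := schemeProgram_time I q R h hd hh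
  exact ⟨t, τ, e, by simpa using ht⟩

lemma vanishingSelectable_coinOCRS : coinOCRS.VanishingSelectable goldenAlpha := by
  refine ⟨fun t => 1200 * t ^ (1 / 20 : ℝ), ?_, fun I =>
    selectableOn_of_isCoinScheme _ (exists_isCoinScheme_schemeProgram I).choose_spec.1⟩
  have h : Continuous fun t : ℝ => 1200 * t ^ (1 / 20 : ℝ) :=
    continuous_const.mul (Real.continuous_rpow_const (by norm_num))
  have h0 := h.tendsto 0
  rw [Real.zero_rpow (by norm_num), mul_zero] at h0
  exact h0.mono_left nhdsWithin_le_nhds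

end Scheme

end Contention

theorem theorem1 :
    IsLeast {a : ℝ | a = (1 - a) ^ 2} ((3 - √5) / 2) ∧
    ∃ ψ : Contention.OCRS, ψ.PolyTime ∧ ψ.VanishingSelectable ((3 - √5) / 2) := by
  refine ⟨⟨Contention.goldenAlpha_eq, fun a ha => ?_⟩, Contention.coinOCRS,
    Contention.polyTime_coinOCRS, Contention.vanishingSelectable_coinOCRS⟩
  -- completing the square in `a = (1 - a) ^ 2`
  have h5 : (2 * a - 3) ^ 2 = 5 := by
    have : a = (1 - a) ^ 2 := ha
    linarith
  have : -√5 ≤ 2 * a - 3 := (abs_le.1 (Real.abs_le_sqrt h5.le)).1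
  linarith
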